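/- Let $\mathbb S^4$ be the unit sphere of $\mathbb R^5$ and write $\sigma=x/|x|$ for $x\neq0$. Let $V\in W^{1,2}_{loc}(\mathbb R^5;\mathbb R^5)$ and $P\in L^1_{loc}(\mathbb R^5)$ have the form $$V(x)=\frac{v(\sigma)+f(\sigma)\,\sigma}{|x|},\qquad P(x)=\frac{p(\sigma)}{|x|^2}\qquad\text{for a.e. }x\in\mathbb R^5,$$ where $f,p:\mathbb S^4\to\mathbb R$ are functions and $v:\mathbb S^4\to\mathbb R^5$ is tangential, i.e. $v(\sigma)\cdot\sigma=0$ for a.e. $\sigma\in\mathbb S^4$. Suppose that $(V,P)$ solves the stationary Euler system $$(V\cdot\nabla)V+\nabla P=0,\qquad \operatorname{div}V=0$$ in $\mathbb R^5$ in the sense of distributions. Then $f=0$ and $|v|^2+2p=0$ almost everywhere on $\mathbb S^4$ (with respect to the surface measure). -/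

import Mathlib

open MeasureTheory
open scoped ContDiff RealInnerProductSpace

/-- Five-dimensional Euclidean space. -/
abbrev E5 : Type := EuclideanSpace ℝ (Fin 5)

/-- The unit sphere of `E5`. -/
abbrev S4 : Type := Metric.sphere (0 : E5) 1

/-- The surface measure on the unit sphere. -/
noncomputable abbrev surfaceMeasure : Measure S4 := (volume : Measure E5).toSphere

/-- The direction `σ = x / |x|` of a nonzero vector. -/
noncomputable def direction (x : E5) (hx : x ≠ 0) : S4 :=
  ⟨‖x‖⁻¹ • x, by
    rw [mem_sphere_zero_iff_norm, norm_smul, norm_inv, norm_norm,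
      inv_mul_cancel₀ (norm_ne_zero_iff.mpr hx)]⟩

/-- Real-valued test functions: smooth with compact support in `E5`. -/
def IsTestFunction (φ : E5 → ℝ) : Prop :=
  ContDiff ℝ ∞ φ ∧ HasCompactSupport φ

/-- `u` belongs to `L^q_loc(E5)`. -/
def MemLpLoc {F : Type*} [NormedAddCommGroup F] (u : E5 → F) (q : ENNReal) : Prop :=
  ∀ K : Set E5, IsCompact K → MemLp u q (volume.restrict K)

/-- `Du` is the weak (distributional) derivative of `u`: both are locally integrable, and
`∫ φ ∂ₑu = - ∫ (∂ₑφ) u` for all test functions `φ` and all directions `e`. -/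
structure HasWeakFDeriv {F : Type*} [NormedAddCommGroup F] [NormedSpace ℝ F]
    (u : E5 → F) (Du : E5 → E5 →L[ℝ] F) : Prop where
  locallyIntegrable : LocallyIntegrable u
  locallyIntegrable_deriv : LocallyIntegrable Du
  integral_eq : ∀ φ : E5 → ℝ, IsTestFunction φ → ∀ e : E5,
    ∫ x, φ x • Du x e = -∫ x, fderiv ℝ φ x e • u x

/-- `u` belongs to `W^{1,2}_loc(E5)`: it is in `L²_loc` and has a weak derivative in `L²_loc`. -/
def MemW12Loc {F : Type*} [NormedAddCommGroup F] [NormedSpace ℝ F] (u : E5 → F) : Prop :=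
  MemLpLoc u 2 ∧ ∃ Du : E5 → E5 →L[ℝ] F, HasWeakFDeriv u Du ∧ MemLpLoc Du 2

/-- `(V, P)` solves the stationary Euler system `(V · ∇) V + ∇ P = 0`, `div V = 0` in `E5` in the
sense of distributions. Here `(V · ∇) V` is the locally integrable function `x ↦ DV x (V x)`, with
`DV` the weak derivative of `V` (which is unique almost everywhere; for `V` in `W^{1,2}_loc` the
local integrability of `(V · ∇) V` is automatic). -/
structure IsStationaryEulerSolution (V : E5 → E5) (P : E5 → ℝ) : Prop where
  locallyIntegrable_velocity : LocallyIntegrable V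
  locallyIntegrable_pressure : LocallyIntegrable P
  div_eq_zero : ∀ φ : E5 → ℝ, IsTestFunction φ → ∫ x, fderiv ℝ φ x (V x) = 0
  momentum : ∃ DV : E5 → E5 →L[ℝ] E5, HasWeakFDeriv V DV ∧
    LocallyIntegrable (fun x => DV x (V x)) ∧
    ∀ φ : E5 → ℝ, IsTestFunction φ → ∀ e : E5,
      (∫ x, φ x * ⟪DV x (V x), e⟫) - ∫ x, P x * fderiv ℝ φ x e = 0

/-! Write F = x · V and g = F²/2 − |x|²(|V|²/2 + P), which are `radialPart` and `transported`. Both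
are homogeneous of degree 0. On the sphere F = f and g = −(|v|² + 2p)/2, so the claim is F = g = 0.

Formally, V · ∇|x|² = 2F, Bernoulli's law says V · ∇(|V|²/2 + P) = 0, and homogeneity gives x · ∇P =
−2P, whence V · ∇F = |V|² + 2P. Therefore V · ∇g = 0 and |x|² V · ∇F = F² − 2g. Since div V = 0, the
integral of V · ∇(|x|² q(|x|²) φ(F, g)) vanishes. Trading the derivative of q for homogeneity of
degree 0 leaves ∫ q(|x|²) [−3Fφ + ∂₁φ (F² − 2g)] = 0, which is `integral_identity`; here −3 = 2 − 5.

For φ = F(αF² + βg + γ) the quartic terms cancel and the bracket becomes (−2β − 6α)F²g − 2γF² − 2βg²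
− 2γg. The choice α = 2/3, β = −2, γ = 0 leaves 4g², so g = 0; then α = β = 0, γ = 1 leaves −2F², so
F = 0.

The analytic work is to justify this for weak derivatives. The chain rule
`integral_fderiv_comp_eq_zero` is proved by mollification for compactly supported functions of (x,
V, P). The truncation in V is then removed using local integrability of (V · ∇)V, and the truncation
in F using local integrability of F⁴. The latter is the critical embedding of W^{1,2} into L⁴ in
dimension four, obtained in `lintegral_homogeneous_lt_top` on hyperplane slices and spread over
cones by homogeneity. The truncation in g costs nothing, because only ∂₁φ enters the identity. -/

open Filter Metric
open scoped Topology Convolution ENNReal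

/-! ### Mollification of locally integrable functions. -/

/-- A sequence of bump functions on `E5` shrinking to the origin. -/
noncomputable def mollifier (n : ℕ) : ContDiffBump (0 : E5) where
  rIn := 1 / ((n : ℝ) + 1) / 2
  rOut := 1 / ((n : ℝ) + 1)
  rIn_pos := by positivity
  rIn_lt_rOut := half_lt_self (by positivity)

/-- Convolution with the normalized `n`-th mollifier. -/
noncomputable def mollify {F : Type*} [NormedAddCommGroup F] [NormedSpace ℝ F] (n : ℕ)
    (W : E5 → F) : E5 → F :=
  (mollifier n).normed volume ⋆[ContinuousLinearMap.lsmul ℝ ℝ, volume] W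

lemma mollifier_rOut_le (n : ℕ) : (mollifier n).rOut ≤ 1 := by
  change 1 / ((n : ℝ) + 1) ≤ 1
  rw [div_le_one (by positivity)]
  linarith [(Nat.cast_nonneg n : (0 : ℝ) ≤ n)]

lemma tendsto_mollifier_rOut : Tendsto (fun n => (mollifier n).rOut) atTop (𝓝 0) :=
  tendsto_one_div_add_atTop_nhds_zero_nat

section Mollify

variable {F : Type*} [NormedAddCommGroup F] [NormedSpace ℝ F]

lemma mollify_apply (n : ℕ) (W : E5 → F) (x : E5) :
    mollify n W x = ∫ y, (mollifier n).normed volume (x - y) • W y := by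
  rw [mollify, convolution_lsmul_swap]

lemma contDiff_mollify [CompleteSpace F] (n : ℕ) {W : E5 → F} (hW : LocallyIntegrable W) :
    ContDiff ℝ ∞ (mollify n W) :=
  ((mollifier n).hasCompactSupport_normed).contDiff_convolution_left _
    (mollifier n).contDiff_normed hW

lemma isTestFunction_mollifier_sub (n : ℕ) (x : E5) :
    IsTestFunction (fun y => (mollifier n).normed volume (x - y)) := by
  refine ⟨(mollifier n).contDiff_normed.comp (contDiff_const.sub contDiff_id), ?_⟩
  exact ((mollifier n).hasCompactSupport_normed).comp_homeomorph (Homeomorph.subLeft x)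

lemma fderiv_mollifier_sub (n : ℕ) (x y e : E5) :
    fderiv ℝ (fun y => (mollifier n).normed volume (x - y)) y e
      = -fderiv ℝ ((mollifier n).normed volume) (x - y) e := by
  have h1 : HasFDerivAt ((mollifier n).normed volume)
      (fderiv ℝ ((mollifier n).normed volume) (x - y)) (x - y) :=
    (((mollifier n).contDiff_normed (n := 1)).differentiable (by simp) _).hasFDerivAt
  have h2 := h1.comp y ((hasFDerivAt_const x y).sub (hasFDerivAt_id y))
  have h3 : fderiv ℝ (fun y => (mollifier n).normed volume (x - y)) y = _ := h2.fderiv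
  rw [h3]
  simp

/-- The derivative of the convolution falls on the kernel, and y ↦ ρ(x − y) is itself a test
function, so the definition of the weak derivative moves it onto `W`. The sign from reflecting the
kernel cancels the sign of the integration by parts. -/
lemma HasWeakFDeriv.hasFDerivAt_mollify [CompleteSpace F] (n : ℕ) {W : E5 → F}
    {DW : E5 → E5 →L[ℝ] F} (h : HasWeakFDeriv W DW) (x : E5) :
    HasFDerivAt (mollify n W) (mollify n DW x) x := by
  have key := ((mollifier n).hasCompactSupport_normed).hasFDerivAt_convolution_left
    (ContinuousLinearMap.lsmul ℝ ℝ : ℝ →L[ℝ] F →L[ℝ] F)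
    ((mollifier n).contDiff_normed (μ := volume)) h.locallyIntegrable x
  refine key.congr_fderiv (ContinuousLinearMap.ext fun e => Eq.symm ?_)
  have hint : Integrable (fun y => (mollifier n).normed volume (x - y) • DW y) :=
    h.locallyIntegrable_deriv.integrable_smul_left_of_hasCompactSupport
      (isTestFunction_mollifier_sub n x).1.continuous (isTestFunction_mollifier_sub n x).2
  rw [mollify_apply, ContinuousLinearMap.integral_apply hint, convolution_eq_swap,
    ContinuousLinearMap.integral_apply]
  · have := h.integral_eq _ (isTestFunction_mollifier_sub n x) e
    simp only [smul_apply]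
    rw [this, ← integral_neg]
    simp [fderiv_mollifier_sub]
  · have h1 := ((mollifier n).hasCompactSupport_normed (μ := volume)).fderiv ℝ
    have := h1.convolutionExists_left
      (ContinuousLinearMap.precompL E5 (ContinuousLinearMap.lsmul ℝ ℝ : ℝ →L[ℝ] F →L[ℝ] F))
      (((mollifier n).contDiff_normed (μ := volume) (n := 1)).continuous_fderiv (by simp))
      h.locallyIntegrable x
    exact this.integrable_swap

lemma ae_tendsto_mollify [CompleteSpace F] {W : E5 → F} (hW : LocallyIntegrable W) :
    ∀ᵐ x, Tendsto (fun n => mollify n W x) atTop (𝓝 (W x)) := by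
  refine ContDiffBump.ae_convolution_tendsto_right_of_locallyIntegrable (K := 2)
    tendsto_mollifier_rOut (Eventually.of_forall fun n => ?_) hW
  change 1 / ((n : ℝ) + 1) ≤ 2 * (1 / ((n : ℝ) + 1) / 2)
  linarith

/-- Jensen's inequality and Tonelli's theorem for mollifications. -/
lemma lintegral_enorm_mollify_rpow_le {r : ℝ} (hr : 1 ≤ r) (n : ℕ) {W : E5 → F}
    (hW : AEStronglyMeasurable W) (R : ℝ) :
    ∫⁻ x in closedBall 0 R, ‖mollify n W x‖ₑ ^ r ≤ ∫⁻ x in closedBall 0 (R + 1), ‖W x‖ₑ ^ r := by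
  wlog hW' : StronglyMeasurable W generalizing W
  · have h1 : mollify n W = mollify n (hW.mk W) := by
      ext x
      rw [mollify_apply, mollify_apply]
      apply integral_congr_ae
      filter_upwards [hW.ae_eq_mk] with y hy
      rw [hy]
    have h2 : ∫⁻ x in closedBall 0 (R + 1), ‖W x‖ₑ ^ r
        = ∫⁻ x in closedBall 0 (R + 1), ‖hW.mk W x‖ₑ ^ r := by
      apply lintegral_congr_ae
      filter_upwards [ae_restrict_of_ae hW.ae_eq_mk] with y hy
      rw [hy]
    rw [h1, h2]
    exact this hW.stronglyMeasurable_mk.aestronglyMeasurable hW.stronglyMeasurable_mk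
  set ρ := (mollifier n).normed (volume : Measure E5)
  have hρc : Continuous ρ := (mollifier n).continuous_normed
  have hρ0 : ∀ x, 0 ≤ ρ x := (mollifier n).nonneg_normed
  -- The kernel is a probability density, so mollifying averages translates of `W`. Jensen's
  -- inequality is then the monotonicity of L^r norms for ν, and translations of length at most 1
  -- account for the enlarged radius R + 1.
  set ν : Measure E5 := volume.withDensity fun t => ENNReal.ofReal (ρ t)
  have hm : Measurable fun t => ENNReal.ofReal (ρ t) := hρc.measurable.ennreal_ofReal
  have hν : IsProbabilityMeasure ν := by
    constructor
    rw [withDensity_apply _ MeasurableSet.univ, setLIntegral_univ,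
      ← ofReal_integral_eq_lintegral_ofReal (mollifier n).integrable_normed
        (Eventually.of_forall hρ0), (mollifier n).integral_normed, ENNReal.ofReal_one]
  have hνs : ∀ᵐ t ∂ν, ‖t‖ ≤ 1 := by
    rw [ae_withDensity_iff hm]
    refine Eventually.of_forall fun t ht => ?_
    have h1 : t ∈ Function.support ρ := by
      intro h; rw [h] at ht; simp at ht
    rw [(mollifier n).support_normed_eq, mem_ball_zero_iff] at h1
    exact h1.le.trans (mollifier_rOut_le n)
  have hpt : ∀ x, ‖mollify n W x‖ₑ ^ r ≤ ∫⁻ t, ‖W (x - t)‖ₑ ^ r ∂ν := by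
    intro x
    have hmeas : StronglyMeasurable fun t => W (x - t) :=
      hW'.comp_measurable (measurable_const.sub measurable_id)
    have h1 : ‖mollify n W x‖ₑ ≤ ∫⁻ t, ‖W (x - t)‖ₑ ∂ν := by
      rw [lintegral_withDensity_eq_lintegral_mul _ hm hmeas.enorm, mollify, convolution_def]
      refine (enorm_integral_le_lintegral_enorm _).trans (lintegral_mono fun t => ?_)
      simp only [ContinuousLinearMap.lsmul_apply, enorm_smul, Pi.mul_apply]
      rw [Real.enorm_of_nonneg (hρ0 t)]
    have h2 : ∫⁻ t, ‖W (x - t)‖ₑ ∂ν ≤ (∫⁻ t, ‖W (x - t)‖ₑ ^ r ∂ν) ^ (1 / r) := by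
      have := eLpNorm'_le_eLpNorm'_of_exponent_le (μ := ν) zero_lt_one hr
        hmeas.aestronglyMeasurable
      simpa [eLpNorm'] using this
    have hr0 : 0 < r := by linarith
    calc ‖mollify n W x‖ₑ ^ r ≤ ((∫⁻ t, ‖W (x - t)‖ₑ ^ r ∂ν) ^ (1 / r)) ^ r := by
          gcongr; exact h1.trans h2
      _ = _ := by
          rw [← ENNReal.rpow_mul, one_div, inv_mul_cancel₀ hr0.ne', ENNReal.rpow_one]
  calc ∫⁻ x in closedBall 0 R, ‖mollify n W x‖ₑ ^ r
      ≤ ∫⁻ x in closedBall 0 R, ∫⁻ t, ‖W (x - t)‖ₑ ^ r ∂ν := lintegral_mono hpt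
    _ = ∫⁻ t, (∫⁻ x in closedBall 0 R, ‖W (x - t)‖ₑ ^ r) ∂ν := by
        apply lintegral_lintegral_swap
        have : StronglyMeasurable fun p : E5 × E5 => W (p.1 - p.2) :=
          hW'.comp_measurable (measurable_fst.sub measurable_snd)
        exact (this.enorm.pow_const r).aemeasurable
    _ ≤ ∫⁻ _, (∫⁻ x in closedBall 0 (R + 1), ‖W x‖ₑ ^ r) ∂ν := by
        apply lintegral_mono_ae
        filter_upwards [hνs] with t ht
        rw [← lintegral_indicator measurableSet_closedBall,
          ← lintegral_indicator measurableSet_closedBall,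
          ← lintegral_sub_right_eq_self
            ((closedBall (0 : E5) (R + 1)).indicator fun x => ‖W x‖ₑ ^ r) t]
        refine lintegral_mono fun x => ?_
        by_cases hx : x ∈ closedBall (0 : E5) R
        · have hx' : x - t ∈ closedBall (0 : E5) (R + 1) := by
            rw [mem_closedBall_zero_iff] at hx ⊢
            exact (norm_sub_le _ _).trans (add_le_add hx ht)
          rw [Set.indicator_of_mem hx, Set.indicator_of_mem hx']
        · rw [Set.indicator_of_notMem hx]; exact zero_le
    _ = _ := by simp

lemma tendsto_lintegral_mollify_sub_of_continuous [CompleteSpace F] {g : E5 → F}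
    (hg : Continuous g) (hgs : HasCompactSupport g) (R : ℝ) :
    Tendsto (fun n => ∫⁻ x in closedBall 0 R, ‖mollify n g x - g x‖ₑ) atTop (𝓝 0) := by
  obtain ⟨C, hC⟩ := hgs.exists_bound_of_continuous hg
  have hmol : ∀ n x, ‖mollify n g x - g x‖ ≤ 2 * C := by
    intro n x
    rw [← dist_eq_norm]
    refine ContDiffBump.dist_normed_convolution_le hg.aestronglyMeasurable fun y _ => ?_
    rw [dist_eq_norm]
    exact (norm_sub_le _ _).trans (by linarith [hC x, hC y])
  have := tendsto_lintegral_of_dominated_convergence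
    (μ := volume.restrict (closedBall (0 : E5) R))
    (F := fun n x => ‖mollify n g x - g x‖ₑ) (f := fun _ => 0) (fun _ => ENNReal.ofReal (2 * C))
    (fun n => (((contDiff_mollify n hg.locallyIntegrable).continuous.sub hg).enorm).measurable)
    (fun n => Eventually.of_forall fun x => by
      dsimp only
      rw [← ofReal_norm]; exact ENNReal.ofReal_le_ofReal (hmol n x))
    (by
      rw [lintegral_const]
      exact ENNReal.mul_ne_top ENNReal.ofReal_ne_top
        (by simpa using (measure_closedBall_lt_top (μ := (volume : Measure E5))).ne))
    (Eventually.of_forall fun x => by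
      have := ContDiffBump.convolution_tendsto_right_of_continuous (μ := (volume : Measure E5))
        tendsto_mollifier_rOut hg x
      have h2 := (this.sub_const (g x)).enorm
      rw [sub_self, enorm_zero] at h2
      exact h2)
  simpa using this

/-- An ε/3 argument: approximate `W` in L¹ on the ball of radius R + 1 by a continuous compactly
supported g. The case r = 1 of the Jensen bound controls the mollification of `W` − g on the smaller
ball. -/
lemma tendsto_lintegral_mollify_sub [CompleteSpace F] {W : E5 → F} (hW : LocallyIntegrable W)
    (R : ℝ) :
    Tendsto (fun n => ∫⁻ x in closedBall 0 R, ‖mollify n W x - W x‖ₑ) atTop (𝓝 0) := by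
  rw [ENNReal.tendsto_nhds_zero]
  intro ε hε
  have hε3 : ε / 3 ≠ 0 := by
    simp [hε.ne']
  have hint : Integrable ((closedBall (0 : E5) (R + 1)).indicator W) :=
    (integrable_indicator_iff measurableSet_closedBall).2
      (hW.integrableOn_isCompact (isCompact_closedBall _ _))
  obtain ⟨g, hgs, hgε, hgc, -⟩ := hint.exists_hasCompactSupport_lintegral_sub_le hε3
  have h1 : ∫⁻ x in closedBall (0 : E5) (R + 1), ‖W x - g x‖ₑ ≤ ε / 3 := by
    refine le_trans ?_ hgε
    refine le_trans (le_of_eq ?_) (setLIntegral_le_lintegral (closedBall (0 : E5) (R + 1)) _)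
    refine setLIntegral_congr_fun measurableSet_closedBall fun x hx => ?_
    simp only [Set.indicator_of_mem hx]
  have h1' : ∫⁻ x in closedBall (0 : E5) R, ‖W x - g x‖ₑ ≤ ε / 3 :=
    (lintegral_mono_set (closedBall_subset_closedBall (by linarith))).trans h1
  have hsub : LocallyIntegrable (fun x => W x - g x) := hW.sub hgc.locallyIntegrable
  filter_upwards [(ENNReal.tendsto_nhds_zero.1
    (tendsto_lintegral_mollify_sub_of_continuous hgc hgs R)) (ε / 3) (pos_iff_ne_zero.2 hε3)]
    with n hn
  have h2 : ∫⁻ x in closedBall (0 : E5) R, ‖mollify n (fun x => W x - g x) x‖ₑ ≤ ε / 3 := by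
    have := lintegral_enorm_mollify_rpow_le le_rfl n hsub.aestronglyMeasurable R
    simp only [ENNReal.rpow_one] at this
    exact this.trans h1
  have hlin : ∀ x, mollify n (fun x => W x - g x) x = mollify n W x - mollify n g x := by
    intro x
    simp only [mollify_apply, smul_sub]
    have hφ := isTestFunction_mollifier_sub n x
    exact integral_sub
      (hW.integrable_smul_left_of_hasCompactSupport hφ.1.continuous hφ.2)
      (hgc.locallyIntegrable.integrable_smul_left_of_hasCompactSupport hφ.1.continuous hφ.2)
  have m1 : AEMeasurable (fun x => ‖mollify n (fun x => W x - g x) x‖ₑ)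
      (volume.restrict (closedBall (0 : E5) R)) :=
    (contDiff_mollify n hsub).continuous.enorm.measurable.aemeasurable
  have m2 : AEMeasurable (fun x => ‖mollify n g x - g x‖ₑ)
      (volume.restrict (closedBall (0 : E5) R)) :=
    (((contDiff_mollify n hgc.locallyIntegrable).continuous.sub hgc).enorm).measurable.aemeasurable
  calc ∫⁻ x in closedBall 0 R, ‖mollify n W x - W x‖ₑ
      ≤ ∫⁻ x in closedBall 0 R, (‖mollify n (fun x => W x - g x) x‖ₑ
          + ‖mollify n g x - g x‖ₑ + ‖W x - g x‖ₑ) := by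
        refine lintegral_mono fun x => ?_
        have : mollify n W x - W x = mollify n (fun x => W x - g x) x
          + (mollify n g x - g x) - (W x - g x) := by rw [hlin]; abel
        rw [this]
        exact enorm_sub_le.trans (add_le_add (enorm_add_le _ _) le_rfl)
    _ = _ := by rw [lintegral_add_left' (f := fun x => _ + _) (m1.add m2), lintegral_add_left' m1]
    _ ≤ ε / 3 + ε / 3 + ε / 3 := by gcongr
    _ = ε := ENNReal.add_thirds ε

end Mollify

/-! ### The chain rule for weak derivatives in L¹_loc. -/

lemma LocallyIntegrable.norm_fun {G : Type*} [NormedAddCommGroup G] {A : E5 → G}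
    (hA : LocallyIntegrable A) : LocallyIntegrable fun x => ‖A x‖ :=
  locallyIntegrable_iff.2 fun _ hK => (hA.integrableOn_isCompact hK).norm

/-- A measurable function vanishing outside a ball and bounded by a locally integrable function is
integrable. -/
lemma integrable_of_norm_le_of_locallyIntegrable {G : Type*} [NormedAddCommGroup G]
    {A : E5 → G} {h : E5 → ℝ} (hA : AEStronglyMeasurable A) (hh : LocallyIntegrable h) {R : ℝ}
    (hR : ∀ x, x ∉ closedBall (0 : E5) R → A x = 0) (hb : ∀ᵐ x, ‖A x‖ ≤ h x) :
    Integrable A := by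
  have h1 : IntegrableOn h (closedBall (0 : E5) R) :=
    hh.integrableOn_isCompact (isCompact_closedBall _ _)
  have h2 : IntegrableOn A (closedBall (0 : E5) R) :=
    h1.mono' hA.restrict (ae_restrict_of_ae hb)
  rw [← integrableOn_univ]
  exact h2.of_forall_sdiff_eq_zero MeasurableSet.univ fun x hx => hR x hx.2

lemma integral_fderiv_eq_zero {u : E5 → ℝ} (hu : ContDiff ℝ 1 u) (hs : HasCompactSupport u)
    (e : E5) : ∫ x, fderiv ℝ u x e = 0 := by
  have hc : Continuous fun x => fderiv ℝ u x e := (hu.continuous_fderiv one_ne_zero).clm_apply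
    continuous_const
  have hcs : HasCompactSupport fun x => fderiv ℝ u x e := hs.fderiv_apply ℝ e
  have := integral_mul_fderiv_eq_neg_fderiv_mul_of_integrable (μ := (volume : Measure E5))
    (f := fun _ => (1 : ℝ)) (g := u) (v := e) (by simp)
    (by simpa using hc.integrable_of_hasCompactSupport hcs)
    (by simpa using hu.continuous.integrable_of_hasCompactSupport hs)
    (fun x _ => differentiableAt_const _) (fun x _ => hu.differentiable one_ne_zero x)
  simpa using this

lemma HasCompactSupport.exists_closedBall_fst {X G : Type*} [NormedAddCommGroup X] [Zero G]
    {B : E5 × X → G} (hB : HasCompactSupport B) :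
    ∃ R : ℝ, ∀ z : E5 × X, z.1 ∉ closedBall (0 : E5) R → B z = 0 := by
  obtain ⟨R, hR⟩ := hB.isCompact.isBounded.subset_closedBall 0
  refine ⟨R, fun z hz => ?_⟩
  by_contra h
  have h1 : z ∈ closedBall (0 : E5 × X) R := hR (subset_tsupport _ h)
  rw [mem_closedBall_zero_iff] at h1 hz
  exact hz ((norm_fst_le z).trans h1)

section Chain

variable {X : Type*} [NormedAddCommGroup X] [NormedSpace ℝ X] [CompleteSpace X]

/-- Integral of the weak derivative of `x ↦ B (x, W x)`, computed by the chain rule, vanishes. -/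
theorem HasWeakFDeriv.integral_fderiv_comp_eq_zero {W : E5 → X} {DW : E5 → E5 →L[ℝ] X}
    (h : HasWeakFDeriv W DW) {B : E5 × X → ℝ} (hB : ContDiff ℝ 1 B) (hBs : HasCompactSupport B)
    (e : E5) : ∫ x, fderiv ℝ B (x, W x) (e, DW x e) = 0 := by
  have hDBc : Continuous (fderiv ℝ B) := hB.continuous_fderiv one_ne_zero
  have hDBs : HasCompactSupport (fderiv ℝ B) := hBs.fderiv ℝ
  obtain ⟨M, hM⟩ := hDBs.exists_bound_of_continuous hDBc
  have hM0 : 0 ≤ M := (norm_nonneg _).trans (hM 0)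
  obtain ⟨R, hR⟩ := hDBs.exists_closedBall_fst
  obtain ⟨R', hR'⟩ := hBs.exists_closedBall_fst
  set Wn := fun n => mollify n W
  set Dn := fun n => mollify n DW
  have hWn : ∀ n, ContDiff ℝ ∞ (Wn n) := fun n => contDiff_mollify n h.locallyIntegrable
  have hDn : ∀ n, ContDiff ℝ ∞ (Dn n) := fun n => contDiff_mollify n h.locallyIntegrable_deriv
  have hmW := h.locallyIntegrable.aestronglyMeasurable
  have hmD := h.locallyIntegrable_deriv.aestronglyMeasurable
  have happ := (isBoundedBilinearMap_apply (𝕜 := ℝ) (E := E5 × X) (F := ℝ)).continuous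
  have happ' := (isBoundedBilinearMap_apply (𝕜 := ℝ) (E := E5) (F := X)).continuous
  have hDWe : AEStronglyMeasurable fun x => DW x e :=
    happ'.comp_aestronglyMeasurable (hmD.prodMk aestronglyMeasurable_const)
  -- the smooth identity
  have hsmooth : ∀ n, ∫ x, fderiv ℝ B (x, Wn n x) (e, Dn n x e) = 0 := by
    intro n
    have hu : ContDiff ℝ 1 fun x => B (x, Wn n x) :=
      hB.comp (contDiff_id.prodMk ((hWn n).of_le (by simp)))
    have hus : HasCompactSupport fun x => B (x, Wn n x) :=
      HasCompactSupport.intro (isCompact_closedBall (0 : E5) R') fun x hx => hR' _ hx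
    rw [← integral_fderiv_eq_zero hu hus e]
    refine integral_congr_ae (Eventually.of_forall fun x => ?_)
    have h1 : HasFDerivAt (fun x => B (x, Wn n x)) _ x :=
      ((hB.differentiable one_ne_zero) (x, Wn n x)).hasFDerivAt.comp x
        ((hasFDerivAt_id x).prodMk (h.hasFDerivAt_mollify n x))
    dsimp only
    rw [h1.fderiv]
    rfl
  -- the two error terms
  set A := fun n x => fderiv ℝ B (x, Wn n x) (0, (Dn n x - DW x) e)
  set C := fun n x => fderiv ℝ B (x, Wn n x) (e, DW x e)
  have hfm : ∀ n, AEStronglyMeasurable (fun x => fderiv ℝ B (x, Wn n x)) (volume : Measure E5) :=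
    fun n => (hDBc.comp (continuous_id.prodMk (hWn n).continuous)).aestronglyMeasurable
  have hAm : ∀ n, AEStronglyMeasurable (A n) := fun n =>
    happ.comp_aestronglyMeasurable ((hfm n).prodMk (aestronglyMeasurable_const.prodMk
      (happ'.comp_aestronglyMeasurable
        (((hDn n).continuous.aestronglyMeasurable.sub hmD).prodMk aestronglyMeasurable_const))))
  have hCm : ∀ n, AEStronglyMeasurable (C n) := fun n =>
    happ.comp_aestronglyMeasurable ((hfm n).prodMk (aestronglyMeasurable_const.prodMk hDWe))
  have hAb : ∀ n x, ‖A n x‖ ≤ M * ‖e‖ * ‖Dn n x - DW x‖ := by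
    intro n x
    refine (ContinuousLinearMap.le_opNorm _ _).trans ?_
    have h1 : ‖((0 : E5), (Dn n x - DW x) e)‖ = ‖(Dn n x - DW x) e‖ := by
      rw [Prod.norm_def]; simp
    rw [h1, mul_assoc, mul_comm ‖e‖]
    exact mul_le_mul (hM _) (ContinuousLinearMap.le_opNorm _ _) (norm_nonneg _) hM0
  have hCb : ∀ n x, ‖C n x‖ ≤ M * ‖e‖ * (1 + ‖DW x‖) := by
    intro n x
    refine (ContinuousLinearMap.le_opNorm _ _).trans ?_
    rw [mul_assoc]
    refine mul_le_mul (hM _) ?_ (norm_nonneg _) hM0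
    rw [Prod.norm_def]
    refine max_le ?_ ?_
    · dsimp only
      nlinarith [norm_nonneg e, norm_nonneg (DW x)]
    · refine ((DW x).le_opNorm e).trans ?_
      nlinarith [norm_nonneg e, norm_nonneg (DW x)]
  have hloc : LocallyIntegrable fun x => M * ‖e‖ * (1 + ‖DW x‖) :=
    ((locallyIntegrable_const (1 : ℝ)).add (LocallyIntegrable.norm_fun h.locallyIntegrable_deriv)).smul (M * ‖e‖)
  have hlocA : ∀ n, LocallyIntegrable fun x => M * ‖e‖ * ‖Dn n x - DW x‖ := fun n =>
    (LocallyIntegrable.norm_fun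
      ((hDn n).continuous.locallyIntegrable.sub h.locallyIntegrable_deriv)).smul (M * ‖e‖)
  have hA0 : ∀ n x, x ∉ closedBall (0 : E5) R → A n x = 0 := fun n x hx => by
    simp only [A, hR (x, Wn n x) hx]; rfl
  have hC0 : ∀ n x, x ∉ closedBall (0 : E5) R → C n x = 0 := fun n x hx => by
    simp only [C, hR (x, Wn n x) hx]; rfl
  have hAi : ∀ n, Integrable (A n) := fun n =>
    integrable_of_norm_le_of_locallyIntegrable (hAm n) (hlocA n) (hA0 n)
      (Eventually.of_forall (hAb n))
  have hCi : ∀ n, Integrable (C n) := fun n =>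
    integrable_of_norm_le_of_locallyIntegrable (hCm n) hloc (hC0 n) (Eventually.of_forall (hCb n))
  have hsum : ∀ n, ∫ x, C n x = -∫ x, A n x := by
    intro n
    rw [eq_neg_iff_add_eq_zero, ← integral_add (hCi n) (hAi n), ← hsmooth n]
    congr 1
    ext x
    simp only [A, C]
    rw [← map_add]
    congr 1
    simp
  -- The derivative of B is bounded and supported in |x| ≤ R, so this error is at most M‖e‖ times
  -- the L¹ distance between `Dn n` and `DW` on that ball.
  have hAlim : Tendsto (fun n => ∫ x, A n x) atTop (𝓝 0) := by
    rw [tendsto_iff_enorm_sub_tendsto_zero]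
    have hlim := ENNReal.Tendsto.const_mul (a := ENNReal.ofReal (M * ‖e‖))
      (tendsto_lintegral_mollify_sub h.locallyIntegrable_deriv R) (Or.inr ENNReal.ofReal_ne_top)
    rw [mul_zero] at hlim
    refine tendsto_of_tendsto_of_tendsto_of_le_of_le tendsto_const_nhds hlim
      (fun _ => zero_le) fun n => ?_
    dsimp only
    rw [sub_zero]
    refine (enorm_integral_le_lintegral_enorm _).trans ?_
    rw [← lintegral_const_mul' _ _ ENNReal.ofReal_ne_top,
      ← lintegral_indicator measurableSet_closedBall]
    refine lintegral_mono fun x => ?_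
    by_cases hx : x ∈ closedBall (0 : E5) R
    · rw [Set.indicator_of_mem hx, ← ofReal_norm, ← ofReal_norm,
        ← ENNReal.ofReal_mul (by positivity)]
      exact ENNReal.ofReal_le_ofReal (hAb n x)
    · dsimp only
      rw [hA0 n x hx]; simp
  -- The weak derivative is now fixed and only the argument of the derivative of B moves, so almost
  -- everywhere convergence and domination suffice.
  have hClim : Tendsto (fun n => ∫ x, C n x) atTop
      (𝓝 (∫ x, fderiv ℝ B (x, W x) (e, DW x e))) := by
    refine tendsto_integral_of_dominated_convergence
      ((closedBall (0 : E5) R).indicator fun x => M * ‖e‖ * (1 + ‖DW x‖)) hCm ?_ ?_ ?_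
    · exact (integrable_indicator_iff measurableSet_closedBall).2
        (hloc.integrableOn_isCompact (isCompact_closedBall _ _))
    · refine fun n => Eventually.of_forall fun x => ?_
      by_cases hx : x ∈ closedBall (0 : E5) R
      · rw [Set.indicator_of_mem hx]; exact hCb n x
      · rw [Set.indicator_of_notMem hx, hC0 n x hx, norm_zero]
    · filter_upwards [ae_tendsto_mollify h.locallyIntegrable] with x hx
      have h1 : Tendsto (fun n => (x, Wn n x)) atTop (𝓝 (x, W x)) :=
        tendsto_const_nhds.prodMk_nhds hx
      exact (happ.tendsto (_, _)).comp
        (((hDBc.tendsto _).comp h1).prodMk_nhds tendsto_const_nhds)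
  refine tendsto_nhds_unique hClim ?_
  simpa [hsum] using hAlim.neg

end Chain

/-- Pairing allows the chain rule to treat (V, P) as a single unknown. -/
lemma HasWeakFDeriv.prodMk {X Y : Type*} [NormedAddCommGroup X] [NormedSpace ℝ X]
    [CompleteSpace X] [NormedAddCommGroup Y] [NormedSpace ℝ Y] [CompleteSpace Y]
    {V : E5 → X} {DV : E5 → E5 →L[ℝ] X} {P : E5 → Y} {DP : E5 → E5 →L[ℝ] Y}
    (hV : HasWeakFDeriv V DV) (hP : HasWeakFDeriv P DP) :
    HasWeakFDeriv (fun x => (V x, P x)) (fun x => (DV x).prod (DP x)) where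
  locallyIntegrable := locallyIntegrable_iff.2 fun _ hK =>
    (hV.locallyIntegrable.integrableOn_isCompact hK).prodMk
      (hP.locallyIntegrable.integrableOn_isCompact hK)
  locallyIntegrable_deriv := locallyIntegrable_iff.2 fun _ hK => by
    have h1 := (hV.locallyIntegrable_deriv.integrableOn_isCompact hK).prodMk
      (hP.locallyIntegrable_deriv.integrableOn_isCompact hK)
    exact (ContinuousLinearMap.prodₗᵢ ℝ : (E5 →L[ℝ] X) × (E5 →L[ℝ] Y) ≃ₗᵢ[ℝ] E5 →L[ℝ] X × Y
      ).toContinuousLinearEquiv.toContinuousLinearMap.integrable_comp h1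
  integral_eq φ hφ e := by
    have hDφ : IsTestFunction fun x => fderiv ℝ φ x e :=
      ⟨(hφ.1.fderiv_right (m := ∞) (by simp)).clm_apply contDiff_const, hφ.2.fderiv_apply ℝ e⟩
    have i1 := (hV.locallyIntegrable_deriv.integrable_smul_left_of_hasCompactSupport
      hφ.1.continuous hφ.2).apply_continuousLinearMap e
    have i2 := (hP.locallyIntegrable_deriv.integrable_smul_left_of_hasCompactSupport
      hφ.1.continuous hφ.2).apply_continuousLinearMap e
    have i3 := hV.locallyIntegrable.integrable_smul_left_of_hasCompactSupport
      hDφ.1.continuous hDφ.2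
    have i4 := hP.locallyIntegrable.integrable_smul_left_of_hasCompactSupport
      hDφ.1.continuous hDφ.2
    have h1 := integral_pair i1 i2
    have h2 := integral_pair i3 i4
    simp only [smul_apply] at h1
    simp only [ContinuousLinearMap.prod_apply, Prod.smul_mk]
    rw [h1, h2, hV.integral_eq φ hφ e, hP.integral_eq φ hφ e, Prod.neg_mk]

/-! ### Consequences of the equations: divergence, pressure gradient, transport by V. -/

/-- The `i`-th vector of the standard basis of `E5`. -/
noncomputable def basisVec (i : Fin 5) : E5 := EuclideanSpace.single i 1

lemma sum_smul_basisVec (x : E5) : ∑ i, x i • basisVec i = x := by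
  ext j
  simp [basisVec, Pi.single_apply]

lemma sum_map_basisVec {X : Type*} [NormedAddCommGroup X] [NormedSpace ℝ X] (L : E5 →L[ℝ] X)
    (x : E5) : ∑ i, x i • L (basisVec i) = L x := by
  conv_rhs => rw [← sum_smul_basisVec x]
  simp

lemma inner_basisVec (x : E5) (i : Fin 5) : ⟪x, basisVec i⟫ = x i := by
  simp [basisVec, EuclideanSpace.inner_single_right]

lemma locallyIntegrable_apply {X : Type*} [NormedAddCommGroup X] [NormedSpace ℝ X]
    {D : E5 → E5 →L[ℝ] X} (h : LocallyIntegrable D) (e : E5) :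
    LocallyIntegrable fun x => D x e :=
  locallyIntegrable_iff.2 fun _ hK => (h.integrableOn_isCompact hK).apply_continuousLinearMap e

lemma locallyIntegrable_coord {V : E5 → E5} (h : LocallyIntegrable V) (i : Fin 5) :
    LocallyIntegrable fun x => V x i :=
  locallyIntegrable_iff.2 fun _ hK =>
    (EuclideanSpace.proj (𝕜 := ℝ) i : E5 →L[ℝ] ℝ).integrable_comp (h.integrableOn_isCompact hK)

lemma IsTestFunction.integrable_mul {φ Z : E5 → ℝ} (hφ : IsTestFunction φ)
    (hZ : LocallyIntegrable Z) : Integrable fun x => φ x * Z x := by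
  simpa using hZ.integrable_smul_left_of_hasCompactSupport hφ.1.continuous hφ.2

lemma IsTestFunction.fderiv_apply {φ : E5 → ℝ} (hφ : IsTestFunction φ) (e : E5) :
    IsTestFunction fun x => fderiv ℝ φ x e :=
  ⟨(hφ.1.fderiv_right (m := ∞) (by simp)).clm_apply contDiff_const, hφ.2.fderiv_apply ℝ e⟩

/-- The trace of the weak derivative of a weakly divergence free field vanishes. -/
lemma HasWeakFDeriv.ae_trace_eq_zero {V : E5 → E5} {DV : E5 → E5 →L[ℝ] E5}
    (h : HasWeakFDeriv V DV)
    (hdiv : ∀ φ : E5 → ℝ, IsTestFunction φ → ∫ x, fderiv ℝ φ x (V x) = 0) :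
    ∀ᵐ x, ∑ i, DV x (basisVec i) i = 0 := by
  have hloc : ∀ i, LocallyIntegrable fun x => DV x (basisVec i) i := fun i =>
    locallyIntegrable_coord (locallyIntegrable_apply h.locallyIntegrable_deriv _) i
  refine ae_eq_zero_of_integral_contDiff_smul_eq_zero
    (locallyIntegrable_iff.2 fun K hK =>
      integrable_finsetSum _ fun i _ => (hloc i).integrableOn_isCompact hK) fun φ hφ hφs => ?_
  have ht : IsTestFunction φ := ⟨hφ, hφs⟩
  simp only [smul_eq_mul, Finset.mul_sum]
  rw [integral_finsetSum _ fun i _ => ht.integrable_mul (hloc i)]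
  have h1 : ∀ i, ∫ x, φ x * DV x (basisVec i) i
      = -∫ x, fderiv ℝ φ x (basisVec i) * V x i := by
    intro i
    have h2 := congrArg (fun y : E5 => y i) (h.integral_eq φ ht (basisVec i))
    have h3 := (EuclideanSpace.proj (𝕜 := ℝ) i : E5 →L[ℝ] ℝ).integral_comp_comm
      ((locallyIntegrable_apply h.locallyIntegrable_deriv
        (basisVec i)).integrable_smul_left_of_hasCompactSupport hφ.continuous hφs)
    have h4 := (EuclideanSpace.proj (𝕜 := ℝ) i : E5 →L[ℝ] ℝ).integral_comp_comm
      (h.locallyIntegrable.integrable_smul_left_of_hasCompactSupport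
        (ht.fderiv_apply (basisVec i)).1.continuous (ht.fderiv_apply (basisVec i)).2)
    simp only [EuclideanSpace.coe_proj, PiLp.smul_apply, smul_eq_mul, PiLp.neg_apply]
      at h2 h3 h4
    rw [h3, h2, h4]
  simp only [h1, Finset.sum_neg_distrib]
  rw [← integral_finsetSum _ fun i _ =>
    (ht.fderiv_apply (basisVec i)).integrable_mul (locallyIntegrable_coord h.locallyIntegrable i),
    neg_eq_zero, ← hdiv φ ht]
  refine integral_congr_ae (Eventually.of_forall fun x => ?_)
  dsimp only
  rw [← sum_map_basisVec]
  simp [mul_comm]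

/-- The weak gradient of the pressure. -/
noncomputable def pressureDeriv (a : E5 → E5) (x : E5) : E5 →L[ℝ] ℝ := -innerSL ℝ (a x)

/-- With a = (V · ∇)V, the momentum equation itself supplies the weak gradient of the pressure. This
is what makes the chain rule available for P. -/
lemma hasWeakFDeriv_pressure {a : E5 → E5} {P : E5 → ℝ} (ha : LocallyIntegrable a)
    (hP : LocallyIntegrable P)
    (h : ∀ φ : E5 → ℝ, IsTestFunction φ → ∀ e : E5,
      (∫ x, φ x * ⟪a x, e⟫) - ∫ x, P x * fderiv ℝ φ x e = 0) :
    HasWeakFDeriv P (pressureDeriv a) where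
  locallyIntegrable := hP
  locallyIntegrable_deriv := locallyIntegrable_iff.2 fun _ hK =>
    ((innerSL ℝ : E5 →L[ℝ] E5 →L[ℝ] ℝ).integrable_comp (ha.integrableOn_isCompact hK)).neg
  integral_eq φ hφ e := by
    have := h φ hφ e
    simp only [pressureDeriv, neg_apply, innerSL_apply_apply, smul_eq_mul, mul_neg, integral_neg]
    rw [sub_eq_zero.1 this]
    simp only [mul_comm]

/-- `V · ∇` applied to a compactly supported function of `(x, V, P)` integrates to zero. -/
lemma integral_transport_eq_zero {V : E5 → E5} {P : E5 → ℝ} {DV : E5 → E5 →L[ℝ] E5}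
    {DP : E5 → E5 →L[ℝ] ℝ} (hV : HasWeakFDeriv V DV) (hP : HasWeakFDeriv P DP)
    (htr : ∀ᵐ x, ∑ i, DV x (basisVec i) i = 0) {b : E5 × E5 × ℝ → ℝ} (hb : ContDiff ℝ 1 b)
    (hbs : HasCompactSupport b) :
    ∫ x, fderiv ℝ b (x, V x, P x) (V x, DV x (V x), DP x (V x)) = 0 := by
  have hW := hV.prodMk hP
  set W : E5 → E5 × ℝ := fun x => (V x, P x)
  set DW : E5 → E5 →L[ℝ] E5 × ℝ := fun x => (DV x).prod (DP x)
  set c : Fin 5 → (E5 × E5 × ℝ) →L[ℝ] ℝ := fun i =>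
    (EuclideanSpace.proj (𝕜 := ℝ) i : E5 →L[ℝ] ℝ) ∘L
      (ContinuousLinearMap.fst ℝ E5 ℝ ∘L ContinuousLinearMap.snd ℝ E5 (E5 × ℝ))
  have hc : ∀ i z, c i z = z.2.1 i := fun _ _ => rfl
  -- The field V b(x, V, P) is handled by components, each still compactly supported in (x, V, P).
  -- Its divergence is V · ∇b plus b times the trace of DV, and the trace vanishes.
  set B : Fin 5 → E5 × E5 × ℝ → ℝ := fun i z => c i z * b z
  have hB : ∀ i, ContDiff ℝ 1 (B i) := fun i => (c i).contDiff.mul hb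
  have hBs : ∀ i, HasCompactSupport (B i) := fun i => hbs.mul_left
  have hDB : ∀ i z u, fderiv ℝ (B i) z u = c i z * fderiv ℝ b z u + b z * c i u := by
    intro i z u
    have h1 := (c i).hasFDerivAt (x := z) |>.mul ((hb.differentiable one_ne_zero) z).hasFDerivAt
    have h2 : fderiv ℝ (B i) z = _ := h1.fderiv
    rw [h2]; simp
  have hint : ∀ i, Integrable fun x => fderiv ℝ (B i) (x, W x) (basisVec i, DW x (basisVec i)) := by
    intro i
    have hDc : Continuous (fderiv ℝ (B i)) := (hB i).continuous_fderiv one_ne_zero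
    have hDs : HasCompactSupport (fderiv ℝ (B i)) := (hBs i).fderiv ℝ
    obtain ⟨M, hM⟩ := hDs.exists_bound_of_continuous hDc
    obtain ⟨R, hR⟩ := hDs.exists_closedBall_fst
    have hloc := locallyIntegrable_apply hW.locallyIntegrable_deriv (basisVec i)
    have happ := (isBoundedBilinearMap_apply (𝕜 := ℝ) (E := E5 × E5 × ℝ) (F := ℝ)).continuous
    refine integrable_of_norm_le_of_locallyIntegrable (R := R)
      (h := fun x => M * (‖basisVec i‖ + ‖DW x (basisVec i)‖)) ?_ ?_ ?_ ?_
    · exact happ.comp_aestronglyMeasurable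
        ((hDc.comp_aestronglyMeasurable (aestronglyMeasurable_id.prodMk
          hW.locallyIntegrable.aestronglyMeasurable)).prodMk
        (aestronglyMeasurable_const.prodMk hloc.aestronglyMeasurable))
    · exact ((locallyIntegrable_const _).add (LocallyIntegrable.norm_fun hloc)).smul M
    · intro x hx
      rw [hR (x, W x) hx]; rfl
    · refine Eventually.of_forall fun x => (ContinuousLinearMap.le_opNorm _ _).trans ?_
      refine mul_le_mul (hM _) ?_ (norm_nonneg _) ((norm_nonneg _).trans (hM 0))
      rw [Prod.norm_def]
      exact max_le (le_add_of_nonneg_right (norm_nonneg _))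
        (le_add_of_nonneg_left (norm_nonneg _))
  have hsum : ∑ i, ∫ x, fderiv ℝ (B i) (x, W x) (basisVec i, DW x (basisVec i)) = 0 :=
    Finset.sum_eq_zero fun i _ => hW.integral_fderiv_comp_eq_zero (hB i) (hBs i) (basisVec i)
  rw [← integral_finsetSum _ fun i _ => hint i] at hsum
  rw [← hsum]
  apply integral_congr_ae
  filter_upwards [htr] with x hx
  simp only [hDB, Finset.sum_add_distrib]
  have h1 : ∑ i, b (x, W x) * c i (basisVec i, DW x (basisVec i)) = 0 := by
    rw [← Finset.mul_sum]
    exact mul_eq_zero_of_right _ hx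
  rw [h1, add_zero]
  have h2 := sum_map_basisVec ((fderiv ℝ b (x, W x)) ∘L
    ((ContinuousLinearMap.id ℝ E5).prod (DW x))) (V x)
  simp only [smul_eq_mul, ContinuousLinearMap.comp_apply, ContinuousLinearMap.prod_apply,
    ContinuousLinearMap.id_apply] at h2
  exact h2.symm

/-! ### Homogeneity and Euler's identity. -/

lemma direction_smul {l : ℝ} (hl : 0 < l) {x : E5} (hx : x ≠ 0) (hlx : l • x ≠ 0) :
    direction (l • x) hlx = direction x hx := by
  apply Subtype.ext
  simp only [direction, norm_smul, Real.norm_eq_abs, abs_of_pos hl, smul_smul]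
  congr 1
  field_simp

/-- `Z` is almost everywhere homogeneous of degree `-m`. -/
def IsHomogeneousAE (m : ℕ) (Z : E5 → ℝ) : Prop :=
  ∀ l : ℝ, 0 < l → ∀ᵐ x, Z (l • x) = (l ^ m)⁻¹ * Z x

lemma ae_comp_smul {Q : E5 → Prop} (h : ∀ᵐ x, Q x) {l : ℝ} (hl : 0 < l) :
    ∀ᵐ x : E5, Q (l • x) :=
  ((Measure.quasiMeasurePreserving_smul (volume : Measure E5) hl.ne')).ae h

lemma ae_ne_zero_E5 : ∀ᵐ x : E5, x ≠ 0 := by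
  simp [ae_iff]

lemma isHomogeneousAE_of_direction {m : ℕ} {Z : E5 → ℝ} {z : S4 → ℝ}
    (h : ∀ᵐ x : E5, ∀ hx : x ≠ 0, Z x = z (direction x hx) / ‖x‖ ^ m) : IsHomogeneousAE m Z := by
  intro l hl
  filter_upwards [h, ae_comp_smul h hl, ae_ne_zero_E5] with x h1 h2 hx
  have hlx : l • x ≠ 0 := smul_ne_zero hl.ne' hx
  rw [h1 hx, h2 hlx, direction_smul hl hx hlx, norm_smul, Real.norm_eq_abs, abs_of_pos hl, mul_pow]
  have := norm_pos_iff.2 hx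
  field_simp

/-- Euler's identity for homogeneous functions, in weak form. -/
lemma IsHomogeneousAE.integral_mul_fderiv_self {m : ℕ} {Z : E5 → ℝ} (hZ : IsHomogeneousAE m Z)
    (hloc : LocallyIntegrable Z) {φ : E5 → ℝ} (hφ : IsTestFunction φ) :
    ∫ x, fderiv ℝ φ x x * Z x = ((m : ℝ) - 5) * ∫ x, φ x * Z x := by
  -- The derivative of J at 1 is computed in two ways: a change of variables and homogeneity show
  -- that J is a multiple of l^(m − 5), while differentiation under the integral falls on φ.
  set J : ℝ → ℝ := fun l => ∫ x, φ (l • x) * Z x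
  have hJ : ∀ l : ℝ, 0 < l → J l = l ^ ((m : ℤ) - 5) * ∫ x, φ x * Z x := by
    intro l hl
    have h1 : J l = ∫ x, l ^ m * (φ (l • x) * Z (l • x)) := by
      apply integral_congr_ae
      filter_upwards [hZ l hl] with x hx
      rw [hx]
      field_simp
    rw [h1, integral_const_mul, Measure.integral_comp_smul volume (fun y => φ y * Z y) l,
      smul_eq_mul, abs_of_pos (by positivity), ← mul_assoc]
    congr 1
    rw [zpow_sub₀ hl.ne']
    simp [div_eq_mul_inv]
  have hd1 : HasDerivAt J (((m : ℝ) - 5) * ∫ x, φ x * Z x) 1 := by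
    have h1 := (hasDerivAt_zpow ((m : ℤ) - 5) (1 : ℝ) (Or.inl one_ne_zero)).mul_const
      (∫ x, φ x * Z x)
    simp only [one_zpow, mul_one, Int.cast_sub, Int.cast_natCast, Int.cast_ofNat] at h1
    refine h1.congr_of_eventuallyEq ?_
    filter_upwards [lt_mem_nhds (zero_lt_one' ℝ)] with l hl using hJ l hl
  have hDc : Continuous (fderiv ℝ φ) := hφ.1.continuous_fderiv (by simp)
  obtain ⟨M, hM⟩ := (hφ.2.fderiv ℝ).exists_bound_of_continuous hDc
  have hM0 : 0 ≤ M := (norm_nonneg _).trans (hM 0)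
  obtain ⟨R, hR⟩ := (hφ.2.fderiv ℝ).isCompact.isBounded.subset_closedBall 0
  have hD0 : ∀ x, x ∉ closedBall (0 : E5) R → fderiv ℝ φ x = 0 := fun x hx => by
    by_contra h
    exact hx (hR (subset_tsupport _ h))
  have hmeas : ∀ l : ℝ, AEStronglyMeasurable fun x => φ (l • x) * Z x := fun l =>
    ((hφ.1.continuous.comp (continuous_const_smul l)).aestronglyMeasurable).mul
      hloc.aestronglyMeasurable
  have hd2 := (hasDerivAt_integral_of_dominated_loc_of_deriv_le (μ := (volume : Measure E5))
    (F := fun (l : ℝ) x => φ (l • x) * Z x)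
    (F' := fun (l : ℝ) x => fderiv ℝ φ (l • x) x * Z x) (x₀ := 1)
    (bound := (closedBall (0 : E5) (2 * R)).indicator fun x => M * (2 * R) * ‖Z x‖)
    -- For l > 1/2, a point x with l x in the ball of radius R lies in the ball of radius 2R, which
    -- gives a majorant independent of l.
    (s := Set.Ioi (1 / 2)) (Ioi_mem_nhds (by norm_num)) (Eventually.of_forall hmeas)
    (by simpa using hφ.integrable_mul hloc)
    (by
      exact ((hDc.comp (continuous_const_smul _)).clm_apply
        continuous_id).aestronglyMeasurable.mul hloc.aestronglyMeasurable)
    (by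
      refine Eventually.of_forall fun x l hl => ?_
      rw [Set.mem_Ioi] at hl
      by_cases hx : l • x ∈ closedBall (0 : E5) R
      · have hx2 : x ∈ closedBall (0 : E5) (2 * R) := by
          rw [mem_closedBall_zero_iff] at hx ⊢
          rw [norm_smul, Real.norm_eq_abs, abs_of_pos (by linarith)] at hx
          nlinarith [norm_nonneg x]
        rw [Set.indicator_of_mem hx2, norm_mul]
        refine mul_le_mul_of_nonneg_right ?_ (norm_nonneg _)
        refine (ContinuousLinearMap.le_opNorm _ _).trans ?_
        exact mul_le_mul (hM _) (by simpa using hx2) (norm_nonneg _) hM0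
      · rw [hD0 _ hx]
        simp only [zero_apply, zero_mul, norm_zero]
        refine Set.indicator_nonneg (fun y hy => ?_) x
        have := (norm_nonneg y).trans (mem_closedBall_zero_iff.1 hy)
        positivity)
    (by
      refine (integrable_indicator_iff measurableSet_closedBall).2 ?_
      exact ((hloc.integrableOn_isCompact (isCompact_closedBall _ _)).norm).const_mul _)
    (by
      refine Eventually.of_forall fun x l _ => ?_
      have h1 : HasDerivAt (fun l : ℝ => l • x) ((1 : ℝ) • x) l := (hasDerivAt_id l).smul_const x
      have h2 := ((hφ.1.differentiable (by simp)) (l • x)).hasFDerivAt.comp_hasDerivAt l h1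
      rw [one_smul] at h2
      exact h2.mul_const (Z x))).2
  simpa using hd2.unique hd1

/-- The radial derivative of the pressure. -/
lemma ae_inner_self_eq_two_mul {a : E5 → E5} {P : E5 → ℝ} (ha : LocallyIntegrable a)
    (hP : LocallyIntegrable P) (hhom : IsHomogeneousAE 2 P)
    (h : ∀ φ : E5 → ℝ, IsTestFunction φ → ∀ e : E5,
      (∫ x, φ x * ⟪a x, e⟫) - ∫ x, P x * fderiv ℝ φ x e = 0) :
    ∀ᵐ x, ⟪x, a x⟫ = 2 * P x := by
  have hcx : ∀ i : Fin 5, Continuous fun x : E5 => x i := fun i =>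
    (EuclideanSpace.proj (𝕜 := ℝ) i : E5 →L[ℝ] ℝ).continuous
  have hai : ∀ i, LocallyIntegrable fun x => x i * a x i := fun i =>
    locallyIntegrable_iff.2 fun K hK =>
      ((locallyIntegrable_coord ha i).integrableOn_isCompact hK).continuousOn_mul
        (hcx i).continuousOn hK
  have hin : ∀ x, ⟪x, a x⟫ = ∑ i, x i * a x i := fun x => by
    simp [PiLp.inner_apply, mul_comm]
  refine ae_eq_of_integral_contDiff_smul_eq ?_ (hP.smul (2 : ℝ)) fun φ hφ hφs => ?_
  · simp only [hin]
    exact locallyIntegrable_iff.2 fun K hK =>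
      integrable_finsetSum _ fun i _ => (hai i).integrableOn_isCompact hK
  have ht : IsTestFunction φ := ⟨hφ, hφs⟩
  set c : Fin 5 → E5 →L[ℝ] ℝ := fun i => EuclideanSpace.proj (𝕜 := ℝ) i
  have hc : ∀ i x, c i x = x i := fun _ _ => rfl
  -- Testing with x_i φ in the direction e_i and summing gives ∫ φ x · a = ∫ P (5φ + x · ∇φ).
  -- Euler's identity with m = 2 turns the right side into (5 + 2 − 5) ∫ φ P.
  have hti : ∀ i, IsTestFunction fun x => φ x * c i x := fun i =>
    ⟨hφ.mul (c i).contDiff, hφs.mul_right⟩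
  have hD : ∀ i x, fderiv ℝ (fun x => φ x * c i x) x (basisVec i)
      = φ x + x i * fderiv ℝ φ x (basisVec i) := by
    intro i x
    have h1 := ((hφ.differentiable (by simp)) x).hasFDerivAt.mul ((c i).hasFDerivAt (x := x))
    have h2 : fderiv ℝ (fun x => φ x * c i x) x = _ := h1.fderiv
    rw [h2]
    simp [hc, basisVec]
  have hi : ∀ i, ∫ x, φ x * (x i * a x i)
      = ∫ x, P x * (φ x + x i * fderiv ℝ φ x (basisVec i)) := by
    intro i
    have h1 := sub_eq_zero.1 (h _ (hti i) (basisVec i))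
    simp only [hD, inner_basisVec] at h1
    rw [← h1]
    simp only [mul_assoc, hc]
  have hint1 : ∀ i, Integrable fun x => P x * (φ x + x i * fderiv ℝ φ x (basisVec i)) := by
    intro i
    have h1 := ((hti i).fderiv_apply (basisVec i)).integrable_mul hP
    simp only [hD] at h1
    simpa only [mul_comm] using h1
  have hEuler := hhom.integral_mul_fderiv_self hP ht
  have hself : Integrable fun x => fderiv ℝ φ x x * P x := by
    have hc1 : Continuous fun x => fderiv ℝ φ x x :=
      (hφ.continuous_fderiv (by simp)).clm_apply continuous_id
    have hs1 : HasCompactSupport fun x => fderiv ℝ φ x x :=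
      (hφs.fderiv ℝ).mono fun x hx h0 => hx (by dsimp only; rw [h0]; rfl)
    simpa using hP.integrable_smul_left_of_hasCompactSupport hc1 hs1
  calc ∫ x, φ x • ⟪x, a x⟫ = ∑ i, ∫ x, φ x * (x i * a x i) := by
        rw [← integral_finsetSum _ fun i _ => ht.integrable_mul (hai i)]
        simp only [hin, smul_eq_mul, Finset.mul_sum]
    _ = ∫ x, ∑ i, P x * (φ x + x i * fderiv ℝ φ x (basisVec i)) := by
        rw [integral_finsetSum _ fun i _ => hint1 i]
        exact Finset.sum_congr rfl fun i _ => hi i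
    _ = ∫ x, (5 * (φ x * P x) + fderiv ℝ φ x x * P x) := by
        congr 1
        ext x
        rw [← Finset.mul_sum, Finset.sum_add_distrib]
        have := sum_map_basisVec (fderiv ℝ φ x) x
        simp only [smul_eq_mul] at this
        rw [this]
        simp
        ring
    _ = 5 * (∫ x, φ x * P x) + ((2 : ℕ) - 5) * ∫ x, φ x * P x := by
        rw [integral_add ((ht.integrable_mul hP).const_mul 5) hself, integral_const_mul, hEuler]
    _ = ∫ x, φ x • (2 : ℝ) • P x := by
        simp only [smul_eq_mul, mul_left_comm _ (2 : ℝ)]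
        rw [integral_const_mul]
        push_cast
        ring

/-! ### The integral identity for functions of F and g. -/

/-- The radial component `x · V` of the velocity. -/
noncomputable def radialPart (V : E5 → E5) (x : E5) : ℝ := ⟪x, V x⟫

/-- The quantity `(x · V)² / 2 - |x|² (|V|² / 2 + P)` transported by `V`. -/
noncomputable def transported (V : E5 → E5) (P : E5 → ℝ) (x : E5) : ℝ :=
  radialPart V x ^ 2 / 2 - ‖x‖ ^ 2 * (‖V x‖ ^ 2 / 2 + P x)

/-- The pointwise almost everywhere and weak facts about a `-1`-homogeneous solution used below. -/
structure IsHomogeneousSolution (V : E5 → E5) (P : E5 → ℝ) (DV : E5 → E5 →L[ℝ] E5) : Prop where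
  weak_velocity : HasWeakFDeriv V DV
  locallyIntegrable_acceleration : LocallyIntegrable fun x => DV x (V x)
  weak_pressure : HasWeakFDeriv P (pressureDeriv fun x => DV x (V x))
  trace_eq_zero : ∀ᵐ x, ∑ i, DV x (basisVec i) i = 0
  inner_acceleration : ∀ᵐ x, ⟪x, DV x (V x)⟫ = 2 * P x
  homogeneous_radialPart : IsHomogeneousAE 0 (radialPart V)
  homogeneous_transported : IsHomogeneousAE 0 (transported V P)

section Curve

variable {q : ℝ → ℝ} {φ : ℝ × ℝ → ℝ}

/-- `|x|² q(|x|²) φ(x · V, γ)` as a function of `(x, V, P)`. -/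
noncomputable def profile (q : ℝ → ℝ) (φ : ℝ × ℝ → ℝ) (z : E5 × E5 × ℝ) : ℝ :=
  ‖z.1‖ ^ 2 * q (‖z.1‖ ^ 2) *
    φ (⟪z.1, z.2.1⟫, ⟪z.1, z.2.1⟫ ^ 2 / 2 - ‖z.1‖ ^ 2 * (‖z.2.1‖ ^ 2 / 2 + z.2.2))

lemma contDiff_profile (hq : ContDiff ℝ ∞ q) (hφ : ContDiff ℝ 1 φ) :
    ContDiff ℝ 1 (profile q φ) := by
  have hq1 : ContDiff ℝ 1 q := hq.of_le (by simp)
  have h1 : ContDiff ℝ 1 fun z : E5 × E5 × ℝ => ‖z.1‖ ^ 2 := contDiff_fst.norm_sq ℝ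
  have h2 : ContDiff ℝ 1 fun z : E5 × E5 × ℝ => z.2.1 := contDiff_fst.comp contDiff_snd
  have h3 : ContDiff ℝ 1 fun z : E5 × E5 × ℝ => z.2.2 := contDiff_snd.comp contDiff_snd
  have h4 : ContDiff ℝ 1 fun z : E5 × E5 × ℝ => ⟪z.1, z.2.1⟫ := contDiff_fst.inner ℝ h2
  exact (h1.mul (hq1.comp h1)).mul (hφ.comp (h4.prodMk
    (((h4.pow 2).div_const 2).sub (h1.mul (((h2.norm_sq ℝ).div_const 2).add h3)))))

/-- The derivative of `profile` along the flow. -/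
lemma fderiv_profile (hq : ContDiff ℝ ∞ q) (hφ : ContDiff ℝ 1 φ) {x v a : E5} {p : ℝ}
    (hxa : ⟪x, a⟫ = 2 * p) {f g : ℝ} (hf : f = ⟪x, v⟫)
    (hg : g = f ^ 2 / 2 - ‖x‖ ^ 2 * (‖v‖ ^ 2 / 2 + p)) :
    fderiv ℝ (profile q φ) (x, v, p) (v, a, -⟪a, v⟫)
      = 2 * (q (‖x‖ ^ 2) + ‖x‖ ^ 2 * deriv q (‖x‖ ^ 2)) * (f * φ (f, g))
        + q (‖x‖ ^ 2) * (fderiv ℝ φ (f, g) (1, 0) * (f ^ 2 - 2 * g)) := by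
  -- The derivative is taken along a straight line whose velocity is that of the flow: x moves by V,
  -- V by (V · ∇)V and P by V · ∇P = −⟪(V · ∇)V, V⟫.
  have hX : HasDerivAt (fun t : ℝ => x + t • v) v 0 := by
    simpa using ((hasDerivAt_id (0 : ℝ)).smul_const v).const_add x
  have hY : HasDerivAt (fun t : ℝ => v + t • a) a 0 := by
    simpa using ((hasDerivAt_id (0 : ℝ)).smul_const a).const_add v
  have hp : HasDerivAt (fun t : ℝ => p + t • (-⟪a, v⟫)) (-⟪a, v⟫) 0 := by
    simpa using ((hasDerivAt_id (0 : ℝ)).smul_const (-⟪a, v⟫)).const_add p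
  have hcurve := hX.prodMk (hY.prodMk hp)
  have hz : (x + (0 : ℝ) • v, v + (0 : ℝ) • a, p + (0 : ℝ) • (-⟪a, v⟫)) = (x, v, p) := by simp
  have hL : HasDerivAt (fun t : ℝ => profile q φ (x + t • v, v + t • a, p + t • (-⟪a, v⟫)))
      (fderiv ℝ (profile q φ) (x, v, p) (v, a, -⟪a, v⟫)) 0 := by
    have h1 := ((contDiff_profile hq hφ).differentiable one_ne_zero
      (x + (0 : ℝ) • v, v + (0 : ℝ) • a, p + (0 : ℝ) • (-⟪a, v⟫))).hasFDerivAt.comp_hasDerivAt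
        (0 : ℝ) hcurve
    rwa [hz] at h1
  have hF : HasDerivAt (fun t : ℝ => ⟪x + t • v, v + t • a⟫) (2 * p + ‖v‖ ^ 2) 0 := by
    refine (hX.inner ℝ hY).congr_deriv ?_
    rw [zero_smul, zero_smul, add_zero, add_zero, hxa, real_inner_self_eq_norm_sq]
  have hs : HasDerivAt (fun t : ℝ => ‖x + t • v‖ ^ 2) (2 * f) 0 :=
    hX.norm_sq.congr_deriv (by rw [zero_smul, add_zero, hf])
  have hy : HasDerivAt (fun t : ℝ => ‖v + t • a‖ ^ 2) (2 * ⟪a, v⟫) 0 :=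
    hY.norm_sq.congr_deriv (by rw [zero_smul, add_zero, real_inner_comm])
  have hF0 : ⟪x + (0 : ℝ) • v, v + (0 : ℝ) • a⟫ = f := by
    rw [zero_smul, zero_smul, add_zero, add_zero, hf]
  have hs0 : ‖x + (0 : ℝ) • v‖ ^ 2 = ‖x‖ ^ 2 := by rw [zero_smul, add_zero]
  have hy0 : ‖v + (0 : ℝ) • a‖ ^ 2 / 2 + (p + (0 : ℝ) • (-⟪a, v⟫)) = ‖v‖ ^ 2 / 2 + p := by simp
  -- The change f(2p + |v|²) of F²/2 cancels 2f(|v|²/2 + p), which comes from |x|², and |v|²/2 + p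
  -- is stationary by Bernoulli's law.
  have hγ : HasDerivAt (fun t : ℝ => ⟪x + t • v, v + t • a⟫ ^ 2 / 2
      - ‖x + t • v‖ ^ 2 * (‖v + t • a‖ ^ 2 / 2 + (p + t • (-⟪a, v⟫)))) 0 0 := by
    refine (((hF.pow 2).div_const 2).sub
      (hs.mul ((hy.div_const 2).add hp))).congr_deriv ?_
    simp only [Pi.add_apply]
    rw [hF0, hs0, hy0]
    push_cast
    ring
  have hφd : HasDerivAt (fun t : ℝ => φ (⟪x + t • v, v + t • a⟫, ⟪x + t • v, v + t • a⟫ ^ 2 / 2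
      - ‖x + t • v‖ ^ 2 * (‖v + t • a‖ ^ 2 / 2 + (p + t • (-⟪a, v⟫)))))
      (fderiv ℝ φ (f, g) (2 * p + ‖v‖ ^ 2, 0)) 0 := by
    have h1 := (hφ.differentiable one_ne_zero (⟪x + (0 : ℝ) • v, v + (0 : ℝ) • a⟫,
      ⟪x + (0 : ℝ) • v, v + (0 : ℝ) • a⟫ ^ 2 / 2 - ‖x + (0 : ℝ) • v‖ ^ 2 *
        (‖v + (0 : ℝ) • a‖ ^ 2 / 2 + (p + (0 : ℝ) • (-⟪a, v⟫))))).hasFDerivAt.comp_hasDerivAt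
          (0 : ℝ) (hF.prodMk hγ)
    rw [hF0, hs0, hy0, ← hg] at h1
    exact h1
  have hqd : HasDerivAt (fun t : ℝ => q (‖x + t • v‖ ^ 2)) (deriv q (‖x‖ ^ 2) * (2 * f)) 0 := by
    have h1 := ((hq.differentiable (by simp)) (‖x + (0 : ℝ) • v‖ ^ 2)).hasDerivAt.comp (0 : ℝ) hs
    rw [hs0] at h1
    exact h1
  have key := hL.unique ((hs.mul hqd).mul hφd)
  rw [key]
  simp only [Pi.mul_apply]
  rw [hF0, hs0, hy0, ← hg]
  have hpair : fderiv ℝ φ (f, g) (2 * p + ‖v‖ ^ 2, 0)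
      = (2 * p + ‖v‖ ^ 2) * fderiv ℝ φ (f, g) (1, 0) := by
    have : ((2 * p + ‖v‖ ^ 2, 0) : ℝ × ℝ) = (2 * p + ‖v‖ ^ 2) • ((1 : ℝ), (0 : ℝ)) := by simp
    rw [this, map_smul, smul_eq_mul]
  -- The factor ‖x‖² in `profile` serves to turn |V|² + 2P into a function of F and g alone.
  have hfg : f ^ 2 - 2 * g = ‖x‖ ^ 2 * (2 * p + ‖v‖ ^ 2) := by rw [hg]; ring
  rw [hpair, hfg]
  ring

/-- The derivative along the flow of a profile truncated in the velocity. -/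
lemma fderiv_mul_profile (hq : ContDiff ℝ ∞ q) (hφ : ContDiff ℝ 1 φ) {χ : E5 → ℝ}
    (hχ : ContDiff ℝ 1 χ) (c : ℝ) (x v a : E5) (p : ℝ) :
    fderiv ℝ (fun z : E5 × E5 × ℝ => χ (c • z.2.1) * profile q φ z) (x, v, p) (v, a, -⟪a, v⟫)
      = χ (c • v) * fderiv ℝ (profile q φ) (x, v, p) (v, a, -⟪a, v⟫)
        + profile q φ (x, v, p) * (c * fderiv ℝ χ (c • v) a) := by
  have d1 : HasFDerivAt (fun z : E5 × E5 × ℝ => c • z.2.1)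
      (c • (ContinuousLinearMap.fst ℝ E5 ℝ ∘L ContinuousLinearMap.snd ℝ E5 (E5 × ℝ)))
      (x, v, p) :=
    (c • (ContinuousLinearMap.fst ℝ E5 ℝ ∘L
      ContinuousLinearMap.snd ℝ E5 (E5 × ℝ))).hasFDerivAt
  have d2 := ((hχ.differentiable one_ne_zero) (c • v)).hasFDerivAt.comp (x, v, p) d1
  have d3 := d2.mul ((contDiff_profile hq hφ).differentiable one_ne_zero (x, v, p)).hasFDerivAt
  have d4 : fderiv ℝ (fun z : E5 × E5 × ℝ => χ (c • z.2.1) * profile q φ z) (x, v, p)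
    = _ := d3.fderiv
  rw [d4]
  simp

end Curve

section Identity

variable {V : E5 → E5} {P : E5 → ℝ} {DV : E5 → E5 →L[ℝ] E5}

lemma IsHomogeneousSolution.aestronglyMeasurable_radialPart (h : IsHomogeneousSolution V P DV) :
    AEStronglyMeasurable (radialPart V) :=
  aestronglyMeasurable_id.inner h.weak_velocity.locallyIntegrable.aestronglyMeasurable

lemma IsHomogeneousSolution.aestronglyMeasurable_transported
    (h : IsHomogeneousSolution V P DV) : AEStronglyMeasurable (transported V P) := by
  have hV := h.weak_velocity.locallyIntegrable.aestronglyMeasurable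
  have hP := h.weak_pressure.locallyIntegrable.aestronglyMeasurable
  have hs : AEStronglyMeasurable (fun x : E5 => ‖x‖ ^ 2) :=
    (continuous_norm.pow 2).aestronglyMeasurable
  have h2 : AEStronglyMeasurable (fun x : E5 => radialPart V x ^ 2 * 2⁻¹) :=
    (h.aestronglyMeasurable_radialPart.pow 2).mul_const _
  have h3 : AEStronglyMeasurable (fun x : E5 => ‖V x‖ ^ 2 * 2⁻¹ + P x) :=
    ((hV.norm.pow 2).mul_const _).add hP
  refine (h2.sub (hs.mul h3)).congr (Eventually.of_forall fun x => ?_)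
  simp [transported, div_eq_mul_inv]

lemma IsHomogeneousSolution.aestronglyMeasurable_comp (h : IsHomogeneousSolution V P DV)
    {Φ : ℝ × ℝ → ℝ} (hΦ : Continuous Φ) :
    AEStronglyMeasurable fun x => Φ (radialPart V x, transported V P x) :=
  hΦ.comp_aestronglyMeasurable
    (h.aestronglyMeasurable_radialPart.prodMk h.aestronglyMeasurable_transported)

lemma IsHomogeneousSolution.locallyIntegrable_comp (h : IsHomogeneousSolution V P DV)
    {Φ : ℝ × ℝ → ℝ} (hΦ : Continuous Φ) (hs : HasCompactSupport Φ) :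
    LocallyIntegrable fun x => Φ (radialPart V x, transported V P x) := by
  obtain ⟨C, hC⟩ := hs.exists_bound_of_continuous hΦ
  exact (locallyIntegrable_const C).mono (h.aestronglyMeasurable_comp hΦ)
    (Eventually.of_forall fun x => (hC _).trans (Real.le_norm_self C))

lemma IsHomogeneousSolution.homogeneous_comp (h : IsHomogeneousSolution V P DV)
    (Φ : ℝ × ℝ → ℝ) : IsHomogeneousAE 0 fun x => Φ (radialPart V x, transported V P x) := by
  intro l hl
  filter_upwards [h.homogeneous_radialPart l hl, h.homogeneous_transported l hl] with x h1 h2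
  simp only [pow_zero, inv_one, one_mul] at h1 h2 ⊢
  rw [h1, h2]

/-- Radial weights. -/
lemma isTestFunction_radial {q : ℝ → ℝ} (hq : ContDiff ℝ ∞ q) (hqs : HasCompactSupport q) :
    IsTestFunction fun x : E5 => q (‖x‖ ^ 2) := by
  refine ⟨hq.comp (contDiff_id.norm_sq ℝ), ?_⟩
  obtain ⟨R, hR⟩ := hqs.isCompact.isBounded.subset_closedBall 0
  refine HasCompactSupport.intro (isCompact_closedBall (0 : E5) (R + 1)) fun x hx => ?_
  by_contra h0
  have h1 := hR (subset_tsupport _ h0)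
  rw [mem_closedBall_zero_iff, Real.norm_eq_abs, abs_of_nonneg (by positivity)] at h1
  rw [mem_closedBall_zero_iff] at hx
  nlinarith [norm_nonneg x]

lemma fderiv_radial {q : ℝ → ℝ} (hq : ContDiff ℝ ∞ q) (x : E5) :
    fderiv ℝ (fun x : E5 => q (‖x‖ ^ 2)) x x = 2 * (‖x‖ ^ 2 * deriv q (‖x‖ ^ 2)) := by
  have h1 := ((hq.differentiable (by simp)) (‖x‖ ^ 2)).hasDerivAt.comp_hasFDerivAt x
    ((hasFDerivAt_id x).norm_sq)
  have h2 : fderiv ℝ (fun x : E5 => q (‖x‖ ^ 2)) x = _ := h1.fderiv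
  rw [h2]
  simp
  ring

/-- Truncated profiles have compact support. -/
lemma hasCompactSupport_profile_mul {q : ℝ → ℝ} {φ : ℝ × ℝ → ℝ} (hqs : HasCompactSupport q)
    {s₀ : ℝ} (hs₀ : 0 < s₀) (hq0 : ∀ s < s₀, q s = 0) (hφs : HasCompactSupport φ)
    {χ : E5 → ℝ} (hχ : HasCompactSupport χ) :
    HasCompactSupport fun z : E5 × E5 × ℝ => χ z.2.1 * profile q φ z := by
  obtain ⟨S, hS⟩ := hqs.isCompact.isBounded.subset_closedBall 0
  obtain ⟨M, hM⟩ := hφs.isCompact.isBounded.subset_closedBall 0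
  obtain ⟨T, hT⟩ := hχ.isCompact.isBounded.subset_closedBall 0
  refine HasCompactSupport.intro ((isCompact_closedBall (0 : E5) (S + 1)).prod
    ((isCompact_closedBall (0 : E5) T).prod (isCompact_closedBall (0 : ℝ)
      ((((S + 1) * T) ^ 2 / 2 + M) / s₀ + T ^ 2 / 2)))) fun z hz => ?_
  by_contra h0
  refine hz ?_
  obtain ⟨x, v, p⟩ := z
  have h1 : χ v ≠ 0 := fun h => h0 (by simp [h])
  have h2 : q (‖x‖ ^ 2) ≠ 0 := fun h => h0 (by simp [profile, h])
  have h3 : φ (⟪x, v⟫, ⟪x, v⟫ ^ 2 / 2 - ‖x‖ ^ 2 * (‖v‖ ^ 2 / 2 + p)) ≠ 0 :=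
    fun h => h0 (by simp [profile, h])
  have hv := hT (subset_tsupport _ h1)
  have hx := hS (subset_tsupport _ h2)
  have hg := hM (subset_tsupport _ h3)
  rw [mem_closedBall_zero_iff] at hv hx hg
  -- Since q vanishes below s₀, x stays away from the origin. Bounds on x, V and g therefore bound
  -- P.
  have hs : s₀ ≤ ‖x‖ ^ 2 := by
    by_contra hlt
    exact h2 (hq0 _ (not_le.1 hlt))
  rw [Real.norm_eq_abs, abs_of_nonneg (by positivity)] at hx
  have hx' : ‖x‖ ≤ S + 1 := by nlinarith [norm_nonneg x]
  have hg' := (norm_snd_le _).trans hg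
  simp only [Real.norm_eq_abs] at hg'
  have hF : |⟪x, v⟫| ≤ (S + 1) * T :=
    (abs_real_inner_le_norm x v).trans
      (mul_le_mul hx' hv (norm_nonneg _) ((norm_nonneg _).trans hx'))
  have hF2 : ⟪x, v⟫ ^ 2 ≤ ((S + 1) * T) ^ 2 := by
    rw [← sq_abs]
    exact pow_le_pow_left₀ (abs_nonneg _) hF 2
  have hv2 : ‖v‖ ^ 2 ≤ T ^ 2 := pow_le_pow_left₀ (norm_nonneg _) hv 2
  refine ⟨mem_closedBall_zero_iff.2 hx', mem_closedBall_zero_iff.2 hv,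
    mem_closedBall_zero_iff.2 ?_⟩
  set N := ((S + 1) * T) ^ 2 / 2 + M
  have hsum : |‖x‖ ^ 2 * (‖v‖ ^ 2 / 2 + p)| ≤ N := by
    have h5 : ‖x‖ ^ 2 * (‖v‖ ^ 2 / 2 + p)
        = ⟪x, v⟫ ^ 2 / 2 - (⟪x, v⟫ ^ 2 / 2 - ‖x‖ ^ 2 * (‖v‖ ^ 2 / 2 + p)) := by ring
    rw [h5]
    refine (abs_sub _ _).trans (add_le_add ?_ hg')
    rw [abs_of_nonneg (by positivity)]
    linarith
  have hb : |‖v‖ ^ 2 / 2 + p| ≤ N / s₀ := by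
    rw [le_div_iff₀ hs₀]
    rw [abs_mul, abs_of_nonneg (by positivity : 0 ≤ ‖x‖ ^ 2)] at hsum
    nlinarith [abs_nonneg (‖v‖ ^ 2 / 2 + p)]
  rw [Real.norm_eq_abs]
  rw [abs_le] at hb ⊢
  constructor <;> nlinarith [sq_nonneg ‖v‖]

/-- Bounds on x, F and g do not bound V. The weight χ(cV) restores compact support in (x, V, P), at
the price of the last term. -/
lemma IsHomogeneousSolution.integral_truncated_flow_eq_zero (h : IsHomogeneousSolution V P DV)
    {q : ℝ → ℝ} (hq : ContDiff ℝ ∞ q) (hqs : HasCompactSupport q)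
    {s₀ : ℝ} (hs₀ : 0 < s₀) (hq0 : ∀ s < s₀, q s = 0)
    {φ : ℝ × ℝ → ℝ} (hφ : ContDiff ℝ 1 φ) (hφs : HasCompactSupport φ)
    {χ : E5 → ℝ} (hχ : ContDiff ℝ 1 χ) (hχs : HasCompactSupport χ) {c : ℝ} (hc : c ≠ 0) :
    ∫ x, (χ (c • V x) * (2 * (q (‖x‖ ^ 2) + ‖x‖ ^ 2 * deriv q (‖x‖ ^ 2))
        * (radialPart V x * φ (radialPart V x, transported V P x))
      + q (‖x‖ ^ 2) * (fderiv ℝ φ (radialPart V x, transported V P x) (1, 0)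
        * (radialPart V x ^ 2 - 2 * transported V P x)))
      + profile q φ (x, V x, P x) * (c * fderiv ℝ χ (c • V x) (DV x (V x)))) = 0 := by
  have hχc : ContDiff ℝ 1 fun v : E5 => χ (c • v) := hχ.comp (contDiff_const_smul c)
  have hχcs : HasCompactSupport fun v : E5 => χ (c • v) :=
    hχs.comp_homeomorph (Homeomorph.smulOfNeZero c hc)
  have hbc : ContDiff ℝ 1 fun z : E5 × E5 × ℝ => χ (c • z.2.1) * profile q φ z :=
    (hχc.comp (contDiff_fst.comp contDiff_snd)).mul (contDiff_profile hq hφ)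
  have hbs : HasCompactSupport fun z : E5 × E5 × ℝ => χ (c • z.2.1) * profile q φ z :=
    hasCompactSupport_profile_mul (χ := fun v => χ (c • v)) hqs hs₀ hq0 hφs hχcs
  refine Eq.trans (integral_congr_ae ?_)
    (integral_transport_eq_zero h.weak_velocity h.weak_pressure h.trace_eq_zero hbc hbs)
  filter_upwards [h.inner_acceleration] with x hx
  have h1 : pressureDeriv (fun x => DV x (V x)) x (V x) = -⟪DV x (V x), V x⟫ := rfl
  rw [h1, fderiv_mul_profile hq hφ hχ,
    fderiv_profile hq hφ hx (f := radialPart V x) (g := transported V P x) rfl rfl]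

/-- Let c → 0. The error from χ(cV) carries a factor c against (V · ∇)V, which is locally
integrable, so dominated convergence removes the truncation without any higher integrability of V.
-/
lemma IsHomogeneousSolution.integral_flow_eq_zero (h : IsHomogeneousSolution V P DV)
    {q : ℝ → ℝ} (hq : ContDiff ℝ ∞ q) (hqs : HasCompactSupport q)
    {s₀ : ℝ} (hs₀ : 0 < s₀) (hq0 : ∀ s < s₀, q s = 0)
    {φ : ℝ × ℝ → ℝ} (hφ : ContDiff ℝ 1 φ) (hφs : HasCompactSupport φ)
    (hGi : Integrable fun x => 2 * (q (‖x‖ ^ 2) + ‖x‖ ^ 2 * deriv q (‖x‖ ^ 2))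
        * (radialPart V x * φ (radialPart V x, transported V P x))
      + q (‖x‖ ^ 2) * (fderiv ℝ φ (radialPart V x, transported V P x) (1, 0)
        * (radialPart V x ^ 2 - 2 * transported V P x))) :
    ∫ x, (2 * (q (‖x‖ ^ 2) + ‖x‖ ^ 2 * deriv q (‖x‖ ^ 2))
        * (radialPart V x * φ (radialPart V x, transported V P x))
      + q (‖x‖ ^ 2) * (fderiv ℝ φ (radialPart V x, transported V P x) (1, 0)
        * (radialPart V x ^ 2 - 2 * transported V P x))) = 0 := by
  have htq := isTestFunction_radial hq hqs
  set G : E5 → ℝ := fun x => 2 * (q (‖x‖ ^ 2) + ‖x‖ ^ 2 * deriv q (‖x‖ ^ 2))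
        * (radialPart V x * φ (radialPart V x, transported V P x))
      + q (‖x‖ ^ 2) * (fderiv ℝ φ (radialPart V x, transported V P x) (1, 0)
        * (radialPart V x ^ 2 - 2 * transported V P x))
  set a := fun x => DV x (V x) with ha
  set χ : ContDiffBump (0 : E5) := ⟨1, 2, one_pos, one_lt_two⟩
  have hχ1 : ContDiff ℝ 1 χ := χ.contDiff
  obtain ⟨M, hM⟩ := (χ.hasCompactSupport.fderiv ℝ).exists_bound_of_continuous
    (hχ1.continuous_fderiv one_ne_zero)
  set c : ℕ → ℝ := fun n => 1 / ((n : ℝ) + 1)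
  have hc0 : ∀ n, 0 < c n := fun n => by positivity
  have hc1 : ∀ n, c n ≤ 1 := fun n => mollifier_rOut_le n
  have hclim : Tendsto c atTop (𝓝 0) := tendsto_one_div_add_atTop_nhds_zero_nat
  set β : E5 → ℝ := fun x => profile q φ (x, V x, P x)
  have hβ : ∀ x, β x = ‖x‖ ^ 2 * q (‖x‖ ^ 2) * φ (radialPart V x, transported V P x) :=
    fun x => rfl
  set T : ℕ → E5 → ℝ := fun n x => χ (c n • V x) * G x
    + β x * (c n * fderiv ℝ χ (c n • V x) (a x))
  have hT : ∀ n, ∫ x, T n x = 0 := by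
    intro n
    exact h.integral_truncated_flow_eq_zero hq hqs hs₀ hq0 hφ hφs hχ1 χ.hasCompactSupport (hc0 n).ne'
  obtain ⟨N, hN⟩ := hφs.exists_bound_of_continuous hφ.continuous
  have hβb : ∀ x, ‖β x‖ ≤ N * ‖‖x‖ ^ 2 * q (‖x‖ ^ 2)‖ := fun x => by
    rw [hβ, norm_mul, mul_comm N]
    exact mul_le_mul_of_nonneg_left (hN _) (norm_nonneg _)
  have hsq : IsTestFunction fun x : E5 => ‖x‖ ^ 2 * q (‖x‖ ^ 2) :=
    ⟨(contDiff_id.norm_sq ℝ).mul htq.1, htq.2.mul_left⟩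
  have hVm := h.weak_velocity.locallyIntegrable.aestronglyMeasurable
  have ham := h.locallyIntegrable_acceleration.aestronglyMeasurable
  have happ := (isBoundedBilinearMap_apply (𝕜 := ℝ) (E := E5) (F := ℝ)).continuous
  have hlim : Tendsto (fun n => ∫ x, T n x) atTop (𝓝 (∫ x, G x)) := by
    refine tendsto_integral_of_dominated_convergence
      (fun x => ‖G x‖ + M * N * (‖‖x‖ ^ 2 * q (‖x‖ ^ 2)‖ * ‖a x‖)) (fun n => ?_) ?_
      (fun n => Eventually.of_forall fun x => ?_) (Eventually.of_forall fun x => ?_)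
    · have m1 : AEStronglyMeasurable fun x => χ (c n • V x) :=
        χ.continuous.comp_aestronglyMeasurable (hVm.const_smul (c n))
      have m2 : AEStronglyMeasurable β :=
        (hsq.1.continuous.aestronglyMeasurable).mul (h.aestronglyMeasurable_comp hφ.continuous)
      have m3 : AEStronglyMeasurable fun x => fderiv ℝ χ (c n • V x) (a x) :=
        happ.comp_aestronglyMeasurable (((hχ1.continuous_fderiv
          one_ne_zero).comp_aestronglyMeasurable (hVm.const_smul (c n))).prodMk ham)
      exact (m1.mul hGi.aestronglyMeasurable).add (m2.mul (m3.const_mul (c n)))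
    · refine hGi.norm.add (Integrable.const_mul ?_ _)
      have := (h.locallyIntegrable_acceleration).integrable_smul_left_of_hasCompactSupport
        hsq.1.continuous hsq.2
      simpa only [norm_smul] using this.norm
    · refine (norm_add_le _ _).trans (add_le_add ?_ ?_)
      · rw [norm_mul, Real.norm_eq_abs (χ _), abs_of_nonneg χ.nonneg]
        exact mul_le_of_le_one_left (norm_nonneg _) χ.le_one
      · rw [norm_mul, norm_mul, Real.norm_eq_abs (c n), abs_of_pos (hc0 n)]
        have e1 : ‖fderiv ℝ χ (c n • V x) (a x)‖ ≤ M * ‖a x‖ :=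
          (ContinuousLinearMap.le_opNorm _ _).trans
            (mul_le_mul_of_nonneg_right (hM _) (norm_nonneg _))
        have e2 : c n * ‖fderiv ℝ χ (c n • V x) (a x)‖ ≤ M * ‖a x‖ :=
          (mul_le_of_le_one_left (norm_nonneg _) (hc1 n)).trans e1
        calc ‖β x‖ * (c n * ‖fderiv ℝ χ (c n • V x) (a x)‖)
            ≤ (N * ‖‖x‖ ^ 2 * q (‖x‖ ^ 2)‖) * (M * ‖a x‖) :=
              mul_le_mul (hβb x) e2 (mul_nonneg (hc0 n).le (norm_nonneg _))
                ((norm_nonneg _).trans (hβb x))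
          _ = _ := by ring
    · have l0 : Tendsto (fun n => c n • V x) atTop (𝓝 0) := by
        simpa using hclim.smul_const (V x)
      have l1 : Tendsto (fun n => χ (c n • V x)) atTop (𝓝 1) := by
        have := (χ.continuous.tendsto 0).comp l0
        rwa [χ.one_of_mem_closedBall (mem_closedBall_self χ.rIn_pos.le)] at this
      have l2 : Tendsto (fun n => fderiv ℝ χ (c n • V x) (a x)) atTop
          (𝓝 (fderiv ℝ χ 0 (a x))) :=
        (((hχ1.continuous_fderiv one_ne_zero).clm_apply continuous_const).tendsto 0).comp l0
      have := (l1.mul_const (G x)).add ((hclim.mul l2).const_mul (β x))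
      simpa using this
  simp only [hT] at hlim
  exact (tendsto_nhds_unique hlim tendsto_const_nhds)

/-- The integral identity satisfied by every compactly supported function of the radial part and
the transported quantity. -/
theorem IsHomogeneousSolution.integral_identity (h : IsHomogeneousSolution V P DV)
    {q : ℝ → ℝ} (hq : ContDiff ℝ ∞ q) (hqs : HasCompactSupport q)
    {s₀ : ℝ} (hs₀ : 0 < s₀) (hq0 : ∀ s < s₀, q s = 0)
    {φ : ℝ × ℝ → ℝ} (hφ : ContDiff ℝ 1 φ) (hφs : HasCompactSupport φ) :
    ∫ x, q (‖x‖ ^ 2) * (-3 * (radialPart V x * φ (radialPart V x, transported V P x))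
      + fderiv ℝ φ (radialPart V x, transported V P x) (1, 0)
        * (radialPart V x ^ 2 - 2 * transported V P x)) = 0 := by
  set F := radialPart V
  set g := transported V P
  set Φ₁ : ℝ × ℝ → ℝ := fun y => y.1 * φ y
  set Φ₂ : ℝ × ℝ → ℝ := fun y => fderiv ℝ φ y (1, 0) * (y.1 ^ 2 - 2 * y.2)
  have hΦ₁ : Continuous Φ₁ := continuous_fst.mul hφ.continuous
  have hΦ₁s : HasCompactSupport Φ₁ := hφs.mul_left
  have hΦ₂ : Continuous Φ₂ :=
    ((hφ.continuous_fderiv one_ne_zero).clm_apply continuous_const).mul (by fun_prop)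
  have hΦ₂s : HasCompactSupport Φ₂ := (hφs.fderiv_apply ℝ _).mul_right
  have hZ₁ := h.locallyIntegrable_comp hΦ₁ hΦ₁s
  have hZ₂ := h.locallyIntegrable_comp hΦ₂ hΦ₂s
  have htq := isTestFunction_radial hq hqs
  have hrad : IsTestFunction fun x : E5 => 2 * (‖x‖ ^ 2 * deriv q (‖x‖ ^ 2)) := by
    have h1 : ContDiff ℝ ∞ (deriv q) := hq.deriv' (n := ∞)
    have h2 := isTestFunction_radial h1 hqs.deriv
    exact ⟨contDiff_const.mul ((contDiff_id.norm_sq ℝ).mul h2.1), h2.2.mul_left.mul_left⟩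
  set G : E5 → ℝ := fun x =>
    2 * (q (‖x‖ ^ 2) + ‖x‖ ^ 2 * deriv q (‖x‖ ^ 2)) * Φ₁ (F x, g x) + q (‖x‖ ^ 2) * Φ₂ (F x, g x)
  have i1 := htq.integrable_mul hZ₁
  have i2 := hrad.integrable_mul hZ₁
  have i3 := htq.integrable_mul hZ₂
  have hGeq : G = fun x => (2 * (q (‖x‖ ^ 2) * Φ₁ (F x, g x))
      + 2 * (‖x‖ ^ 2 * deriv q (‖x‖ ^ 2)) * Φ₁ (F x, g x)) + q (‖x‖ ^ 2) * Φ₂ (F x, g x) := by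
    ext x; simp only [G]; ring
  have hGi : Integrable G := by
    rw [hGeq]
    exact ((i1.const_mul 2).add i2).add i3
  have hG : ∫ x, G x = 0 :=
    h.integral_flow_eq_zero hq hqs hs₀ hq0 hφ hφs hGi
  -- The term |x|² q′ is half the radial derivative of q(|x|²), so homogeneity of degree 0 replaces
  -- it by −5q/2. Together with the 2q coming from |x|² this makes −3.
  have hEuler := (h.homogeneous_comp Φ₁).integral_mul_fderiv_self hZ₁ htq
  simp only [fderiv_radial hq] at hEuler
  have hG2 : ∫ x, G x = 2 * (∫ x, q (‖x‖ ^ 2) * Φ₁ (F x, g x))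
      + (((0 : ℕ) : ℝ) - 5) * (∫ x, q (‖x‖ ^ 2) * Φ₁ (F x, g x))
      + ∫ x, q (‖x‖ ^ 2) * Φ₂ (F x, g x) := by
    rw [hGeq, integral_add (f := fun x => _ + _) ((i1.const_mul 2).add i2) i3,
      integral_add (i1.const_mul 2) i2, integral_const_mul, hEuler]
  have hfin : ∫ x, q (‖x‖ ^ 2) * (-3 * (F x * φ (F x, g x))
      + fderiv ℝ φ (F x, g x) (1, 0) * (F x ^ 2 - 2 * g x))
      = -3 * (∫ x, q (‖x‖ ^ 2) * Φ₁ (F x, g x)) + ∫ x, q (‖x‖ ^ 2) * Φ₂ (F x, g x) := by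
    rw [← integral_const_mul, ← integral_add (i1.const_mul _) i3]
    congr 1
    ext x
    simp only [Φ₁, Φ₂]
    ring
  have hsum := hG2.symm.trans hG
  push_cast at hsum
  rw [hfin]
  linarith

end Identity

/-! ### Local fourth power integrability of |x||V| by slicing. -/

/-- The parametrization of `E5` which singles out the `i`-th coordinate. -/
noncomputable def sliceMap (i : Fin 5) : ℝ × (Fin 4 → ℝ) →L[ℝ] E5 :=
  LinearMap.toContinuousLinearMap
    { toFun := fun p => WithLp.toLp 2 (i.insertNth (α := fun _ => ℝ) p.1 p.2)
      map_add' := fun p p' => by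
        ext j
        rcases Fin.eq_self_or_eq_succAbove i j with h | ⟨k, h⟩ <;> simp [h]
      map_smul' := fun c p => by
        ext j
        rcases Fin.eq_self_or_eq_succAbove i j with h | ⟨k, h⟩ <;> simp [h] }

lemma sliceMap_apply (i : Fin 5) (p : ℝ × (Fin 4 → ℝ)) :
    sliceMap i p = WithLp.toLp 2 (i.insertNth (α := fun _ => ℝ) p.1 p.2) := rfl

lemma sliceMap_coord (i : Fin 5) (p : ℝ × (Fin 4 → ℝ)) : sliceMap i p i = p.1 := by
  simp [sliceMap_apply]

lemma measurePreserving_sliceMap (i : Fin 5) : MeasurePreserving (sliceMap i) :=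
  (PiLp.volume_preserving_toLp (Fin 5)).comp
    (volume_preserving_piFinSuccAbove (fun _ : Fin 5 => ℝ) i).symm

lemma lintegral_eq_lintegral_slice (i : Fin 5) {f : E5 → ℝ≥0∞} (hf : AEMeasurable f) :
    ∫⁻ x, f x = ∫⁻ t : ℝ, ∫⁻ y : Fin 4 → ℝ, f (sliceMap i (t, y)) := by
  have h1 := hf.comp_quasiMeasurePreserving (measurePreserving_sliceMap i).quasiMeasurePreserving
  rw [← (measurePreserving_sliceMap i).map_eq] at hf ⊢
  rw [lintegral_map' hf (measurePreserving_sliceMap i).measurable.aemeasurable]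
  exact lintegral_prod _ h1

lemma ae_ae_slice (i : Fin 5) {Q : E5 → Prop} (h : ∀ᵐ x, Q x) :
    ∀ᵐ t : ℝ, ∀ᵐ y : Fin 4 → ℝ, Q (sliceMap i (t, y)) :=
  Measure.ae_ae_of_ae_prod ((measurePreserving_sliceMap i).quasiMeasurePreserving.ae h)

/-- The Sobolev inequality on four-dimensional slices, integrated over the slices. -/
lemma lintegral_slice_sobolev (i : Fin 5) : ∃ C : ℝ≥0∞, C ≠ ⊤ ∧ ∀ u : E5 → E5, ContDiff ℝ 1 u →
    HasCompactSupport u →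
    ∫⁻ t : ℝ, (∫⁻ y : Fin 4 → ℝ, ‖u (sliceMap i (t, y))‖ₑ ^ (4 : ℝ)) ^ (1 / 2 : ℝ)
      ≤ C * ∫⁻ x, ‖fderiv ℝ u x‖ₑ ^ (2 : ℝ) := by
  set A : (Fin 4 → ℝ) →L[ℝ] E5 := sliceMap i ∘L ContinuousLinearMap.inr ℝ ℝ (Fin 4 → ℝ)
  set c : ℝ≥0∞ := ((SNormLESNormFDerivOfEqConst E5 (volume : Measure (Fin 4 → ℝ)) (2 : NNReal) :
    NNReal) : ℝ≥0∞)
  have hc : c ≠ ⊤ := ENNReal.coe_ne_top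
  refine ⟨(c * ‖A‖ₑ) ^ (2 : ℝ), ?_, fun u hu hus => ?_⟩
  · exact ENNReal.rpow_ne_top_of_nonneg (by norm_num) (ENNReal.mul_ne_top hc enorm_ne_top)
  have hDc : Continuous (fderiv ℝ u) := hu.continuous_fderiv one_ne_zero
  -- The exponents satisfy 1/4 = 1/2 − 1/4 in dimension four. Squaring the Sobolev inequality makes
  -- its right side an integral over the slice, which can be integrated in t.
  have hslice : ∀ t : ℝ,
      (∫⁻ y : Fin 4 → ℝ, ‖u (sliceMap i (t, y))‖ₑ ^ (4 : ℝ)) ^ (1 / 2 : ℝ)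
        ≤ (c * ‖A‖ₑ) ^ (2 : ℝ)
          * ∫⁻ y : Fin 4 → ℝ, ‖fderiv ℝ u (sliceMap i (t, y))‖ₑ ^ (2 : ℝ) := by
    intro t
    set w : (Fin 4 → ℝ) → E5 := fun y => u (sliceMap i (t, y))
    have hinj : Topology.IsClosedEmbedding fun y : Fin 4 → ℝ => sliceMap i (t, y) := by
      have h1 : ∀ y, sliceMap i (t, y) = sliceMap i (t, 0) + A y := fun y => by
        simp only [A, ContinuousLinearMap.comp_apply, ContinuousLinearMap.inr_apply]
        rw [← map_add]; simp
      have hA : LinearMap.ker (A : (Fin 4 → ℝ) →ₗ[ℝ] E5) = ⊥ := by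
        rw [LinearMap.ker_eq_bot']
        intro y hy
        ext j
        have := congrArg (fun z : E5 => z (i.succAbove j)) hy
        simpa [A, sliceMap_apply] using this
      have h2 := LinearMap.isClosedEmbedding_of_injective hA
      have h3 := (Homeomorph.addLeft (sliceMap i (t, 0))).isClosedEmbedding.comp h2
      convert h3 using 1
      ext1 y
      exact h1 y
    have hw : ContDiff ℝ 1 w :=
      hu.comp ((sliceMap i).contDiff.comp (contDiff_const.prodMk contDiff_id))
    have hws : HasCompactSupport w := hus.comp_isClosedEmbedding hinj
    have hDw : ∀ y, fderiv ℝ w y = fderiv ℝ u (sliceMap i (t, y)) ∘L A := by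
      intro y
      have d1 : HasFDerivAt (fun y : Fin 4 → ℝ => sliceMap i (t, y)) A y :=
        (sliceMap i).hasFDerivAt.comp y ((hasFDerivAt_const t y).prodMk (hasFDerivAt_id y))
      exact ((hu.differentiable one_ne_zero _).hasFDerivAt.comp y d1).fderiv
    have hGNS := eLpNorm_le_eLpNorm_fderiv_of_eq (volume : Measure (Fin 4 → ℝ)) hw hws
      (p := 2) (p' := 4) (by norm_num) (by simp) (by simp; norm_num)
    have e1 : eLpNorm w (4 : NNReal) volume = (∫⁻ y, ‖w y‖ₑ ^ (4 : ℝ)) ^ (1 / 4 : ℝ) := by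
      rw [eLpNorm_nnreal_eq_lintegral (by norm_num)]; norm_num
    have e2 : eLpNorm (fderiv ℝ w) (2 : NNReal) volume
        = (∫⁻ y, ‖fderiv ℝ w y‖ₑ ^ (2 : ℝ)) ^ (1 / 2 : ℝ) := by
      rw [eLpNorm_nnreal_eq_lintegral (by norm_num)]; norm_num
    rw [e1, e2] at hGNS
    have e3 : ∫⁻ y, ‖fderiv ℝ w y‖ₑ ^ (2 : ℝ)
        ≤ ‖A‖ₑ ^ (2 : ℝ) * ∫⁻ y, ‖fderiv ℝ u (sliceMap i (t, y))‖ₑ ^ (2 : ℝ) := by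
      rw [← lintegral_const_mul' _ _ (ENNReal.rpow_ne_top_of_nonneg (by norm_num) enorm_ne_top)]
      refine lintegral_mono fun y => ?_
      rw [hDw, ← ENNReal.mul_rpow_of_nonneg _ _ (by norm_num : (0 : ℝ) ≤ 2), mul_comm]
      gcongr
      rw [← ofReal_norm, ← ofReal_norm, ← ofReal_norm, ← ENNReal.ofReal_mul (norm_nonneg _)]
      exact ENNReal.ofReal_le_ofReal (ContinuousLinearMap.opNorm_comp_le _ _)
    calc (∫⁻ y : Fin 4 → ℝ, ‖w y‖ₑ ^ (4 : ℝ)) ^ (1 / 2 : ℝ)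
        = ((∫⁻ y : Fin 4 → ℝ, ‖w y‖ₑ ^ (4 : ℝ)) ^ (1 / 4 : ℝ)) ^ (2 : ℝ) := by
          rw [← ENNReal.rpow_mul]; norm_num
      _ ≤ (c * (∫⁻ y, ‖fderiv ℝ w y‖ₑ ^ (2 : ℝ)) ^ (1 / 2 : ℝ)) ^ (2 : ℝ) := by
          exact ENNReal.rpow_le_rpow hGNS (by norm_num)
      _ = c ^ (2 : ℝ) * ∫⁻ y, ‖fderiv ℝ w y‖ₑ ^ (2 : ℝ) := by
          rw [ENNReal.mul_rpow_of_nonneg _ _ (by norm_num), ← ENNReal.rpow_mul]; norm_num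
      _ ≤ c ^ (2 : ℝ) * (‖A‖ₑ ^ (2 : ℝ)
            * ∫⁻ y, ‖fderiv ℝ u (sliceMap i (t, y))‖ₑ ^ (2 : ℝ)) := by gcongr
      _ = _ := by rw [ENNReal.mul_rpow_of_nonneg _ _ (by norm_num), mul_assoc]
  refine (lintegral_mono hslice).trans (le_of_eq ?_)
  rw [lintegral_const_mul' _ _ (ENNReal.rpow_ne_top_of_nonneg (by norm_num)
    (ENNReal.mul_ne_top hc enorm_ne_top)),
    lintegral_eq_lintegral_slice i (hDc.enorm.measurable.pow_const _).aemeasurable]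

lemma MemLpLoc.lintegral_lt_top {G : Type*} [NormedAddCommGroup G] {u : E5 → G}
    (h : MemLpLoc u 2) (R : ℝ) : ∫⁻ x in closedBall 0 R, ‖u x‖ₑ ^ (2 : ℝ) < ⊤ := by
  have h1 := h _ (isCompact_closedBall (0 : E5) R)
  have h2 := lintegral_rpow_enorm_lt_top_of_eLpNorm_lt_top (by norm_num) (by norm_num)
    h1.eLpNorm_lt_top
  simpa using h2

/-- `W^{1,2}_loc` functions on `E5` are fourth power integrable on almost every slice. -/
lemma MemW12Loc.ae_lintegral_slice_lt_top {V : E5 → E5} (hV : MemW12Loc V) (i : Fin 5) (N : ℕ) :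
    ∀ᵐ t : ℝ, ∫⁻ y : Fin 4 → ℝ, (closedBall (0 : E5) N).indicator
      (fun x => ‖V x‖ₑ ^ (4 : ℝ)) (sliceMap i (t, y)) < ⊤ := by
  obtain ⟨hV2, DV, hw, hD2⟩ := hV
  obtain ⟨C, hC, hS⟩ := lintegral_slice_sobolev i
  set η : ContDiffBump (0 : E5) := ⟨N + 1, N + 2, by positivity, by linarith⟩
  set R : ℝ := N + 2
  have hη1 : ContDiff ℝ 1 η := η.contDiff
  obtain ⟨M, hM⟩ := (η.hasCompactSupport.fderiv ℝ).exists_bound_of_continuous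
    (hη1.continuous_fderiv one_ne_zero)
  have hM0 : 0 ≤ M := (norm_nonneg _).trans (hM 0)
  have hη0 : ∀ x, x ∉ closedBall (0 : E5) R → η x = 0 := fun x hx =>
    η.zero_of_le_dist (by rw [mem_closedBall] at hx; exact (not_le.1 hx).le)
  set Vn := fun n => mollify n V
  -- Smooth compactly supported approximations that are mollifications of V on the ball of radius N
  -- and have gradients bounded in L² uniformly in n.
  set u : ℕ → E5 → E5 := fun n x => η x • Vn n x
  have hVn : ∀ n, ContDiff ℝ 1 (Vn n) := fun n =>
    (contDiff_mollify n hw.locallyIntegrable).of_le (by simp)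
  have hu : ∀ n, ContDiff ℝ 1 (u n) := fun n => hη1.smul (hVn n)
  have hus : ∀ n, HasCompactSupport (u n) := fun n => η.hasCompactSupport.smul_right
  have hDu : ∀ n x, ‖fderiv ℝ (u n) x‖
      ≤ (closedBall (0 : E5) R).indicator (fun x => ‖mollify n DV x‖ + M * ‖Vn n x‖) x := by
    intro n x
    by_cases hx : x ∈ closedBall (0 : E5) R
    · rw [Set.indicator_of_mem hx]
      have h1 := ((hη1.differentiable one_ne_zero) x).hasFDerivAt.smul
        (hw.hasFDerivAt_mollify n x)
      have h2 : fderiv ℝ (u n) x = _ := h1.fderiv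
      rw [h2]
      refine (norm_add_le _ _).trans (add_le_add ?_ ?_)
      · rw [norm_smul, Real.norm_eq_abs, abs_of_nonneg η.nonneg]
        exact mul_le_of_le_one_left (norm_nonneg _) η.le_one
      · rw [ContinuousLinearMap.norm_smulRight_apply]
        exact mul_le_mul_of_nonneg_right (hM x) (norm_nonneg _)
    · rw [Set.indicator_of_notMem hx]
      have hloc : u n =ᶠ[𝓝 x] fun _ => 0 := by
        filter_upwards [isClosed_closedBall.isOpen_compl.mem_nhds hx] with y hy
        simp only [u, hη0 y hy, zero_smul]
      rw [hloc.fderiv_eq]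
      simp
  set B : ℝ≥0∞ := 2 * ((∫⁻ x in closedBall 0 (R + 1), ‖DV x‖ₑ ^ (2 : ℝ))
    + ENNReal.ofReal M ^ (2 : ℝ) * ∫⁻ x in closedBall 0 (R + 1), ‖V x‖ₑ ^ (2 : ℝ))
  have hB : B ≠ ⊤ := by
    refine ENNReal.mul_ne_top (by norm_num) (ENNReal.add_ne_top.2
      ⟨(hD2.lintegral_lt_top _).ne, ENNReal.mul_ne_top
        (ENNReal.rpow_ne_top_of_nonneg (by norm_num) ENNReal.ofReal_ne_top)
        (hV2.lintegral_lt_top _).ne⟩)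
  have hbound : ∀ n, ∫⁻ x, ‖fderiv ℝ (u n) x‖ₑ ^ (2 : ℝ) ≤ B := by
    intro n
    calc ∫⁻ x, ‖fderiv ℝ (u n) x‖ₑ ^ (2 : ℝ)
        ≤ ∫⁻ x in closedBall 0 R, 2 * (‖mollify n DV x‖ₑ ^ (2 : ℝ)
            + ENNReal.ofReal M ^ (2 : ℝ) * ‖Vn n x‖ₑ ^ (2 : ℝ)) := by
          rw [← lintegral_indicator measurableSet_closedBall]
          refine lintegral_mono fun x => ?_
          have h1 := hDu n x
          by_cases hx : x ∈ closedBall (0 : E5) R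
          · rw [Set.indicator_of_mem hx] at h1 ⊢
            have h2 : ‖fderiv ℝ (u n) x‖ₑ
                ≤ ‖mollify n DV x‖ₑ + ENNReal.ofReal M * ‖Vn n x‖ₑ := by
              rw [← ofReal_norm, ← ofReal_norm, ← ofReal_norm, ← ENNReal.ofReal_mul hM0,
                ← ENNReal.ofReal_add (norm_nonneg _) (by positivity)]
              exact ENNReal.ofReal_le_ofReal h1
            calc ‖fderiv ℝ (u n) x‖ₑ ^ (2 : ℝ)
                ≤ (‖mollify n DV x‖ₑ + ENNReal.ofReal M * ‖Vn n x‖ₑ) ^ (2 : ℝ) := by gcongr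
              _ ≤ 2 ^ ((2 : ℝ) - 1) * (‖mollify n DV x‖ₑ ^ (2 : ℝ)
                    + (ENNReal.ofReal M * ‖Vn n x‖ₑ) ^ (2 : ℝ)) :=
                  ENNReal.rpow_add_le_mul_rpow_add_rpow _ _ (by norm_num)
              _ = _ := by
                  rw [ENNReal.mul_rpow_of_nonneg _ _ (by norm_num)]
                  norm_num
          · rw [Set.indicator_of_notMem hx] at h1 ⊢
            have h2 : ‖fderiv ℝ (u n) x‖ₑ = 0 := by
              rw [← ofReal_norm, ENNReal.ofReal_eq_zero]
              exact h1
            rw [h2, ENNReal.zero_rpow_of_pos (by norm_num)]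
      _ = 2 * ((∫⁻ x in closedBall 0 R, ‖mollify n DV x‖ₑ ^ (2 : ℝ))
            + ENNReal.ofReal M ^ (2 : ℝ) * ∫⁻ x in closedBall 0 R, ‖Vn n x‖ₑ ^ (2 : ℝ)) := by
          have m1 : Measurable fun x => ‖mollify n DV x‖ₑ ^ (2 : ℝ) :=
            ((contDiff_mollify n hw.locallyIntegrable_deriv).continuous.enorm.measurable).pow_const _
          rw [lintegral_const_mul' _ _ (by norm_num), lintegral_add_left m1,
            lintegral_const_mul' _ _ (ENNReal.rpow_ne_top_of_nonneg (by norm_num)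
              ENNReal.ofReal_ne_top)]
      _ ≤ B := by
          refine mul_le_mul_right (add_le_add ?_ (mul_le_mul_right ?_ _)) _
          · exact lintegral_enorm_mollify_rpow_le (by norm_num) n
              hw.locallyIntegrable_deriv.aestronglyMeasurable R
          · exact lintegral_enorm_mollify_rpow_le (by norm_num) n
              hw.locallyIntegrable.aestronglyMeasurable R
  -- Fatou's lemma in the slicing parameter and in the slices
  set J : ℕ → ℝ → ℝ≥0∞ := fun n t => ∫⁻ y : Fin 4 → ℝ, ‖u n (sliceMap i (t, y))‖ₑ ^ (4 : ℝ)
  have hum : ∀ n, Measurable fun p : ℝ × (Fin 4 → ℝ) => ‖u n (sliceMap i p)‖ₑ ^ (4 : ℝ) :=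
    fun n => (((hu n).continuous.comp (sliceMap i).continuous).enorm.measurable).pow_const _
  have hJm : ∀ n, Measurable (J n) := fun n => (hum n).lintegral_prod_right'
  have hfat : ∫⁻ t, liminf (fun n => J n t ^ (1 / 2 : ℝ)) atTop ≤ C * B := by
    refine (lintegral_liminf_le fun n => (hJm n).pow_const _).trans ?_
    refine (liminf_le_liminf (Eventually.of_forall fun n =>
      (hS (u n) (hu n) (hus n)).trans (mul_le_mul_right (hbound n) C))).trans (le_of_eq ?_)
    exact liminf_const _
  have hfin : ∀ᵐ t, liminf (fun n => J n t ^ (1 / 2 : ℝ)) atTop < ⊤ :=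
    ae_lt_top (Measurable.liminf fun n => (hJm n).pow_const _)
      (hfat.trans_lt (ENNReal.mul_lt_top hC.lt_top hB.lt_top)).ne
  filter_upwards [hfin, ae_ae_slice i (ae_tendsto_mollify hw.locallyIntegrable)] with t ht hlim
  have hJfin : liminf (fun n => J n t) atTop < ⊤ := by
    obtain ⟨b, hb1, hb2⟩ := exists_between ht
    have hfreq : ∃ᶠ n in atTop, J n t ^ (1 / 2 : ℝ) < b := 
      frequently_lt_of_liminf_lt (by isBoundedDefault) hb1
    refine lt_of_le_of_lt (liminf_le_of_frequently_le' (x := b ^ (2 : ℝ))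
      (hfreq.mono fun n hn => ?_))
      (ENNReal.rpow_lt_top_of_nonneg (by norm_num) hb2.ne)
    calc J n t = (J n t ^ (1 / 2 : ℝ)) ^ (2 : ℝ) := by rw [← ENNReal.rpow_mul]; norm_num
      _ ≤ b ^ (2 : ℝ) := by gcongr
  refine lt_of_le_of_lt ?_ hJfin
  refine le_trans ?_ (lintegral_liminf_le fun n => (hum n).comp measurable_prodMk_left)
  apply lintegral_mono_ae
  filter_upwards [hlim] with y hy
  by_cases hx : sliceMap i (t, y) ∈ closedBall (0 : E5) N
  · rw [Set.indicator_of_mem hx]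
    have h1 : Tendsto (fun n => ‖u n (sliceMap i (t, y))‖ₑ ^ (4 : ℝ)) atTop
        (𝓝 (‖V (sliceMap i (t, y))‖ₑ ^ (4 : ℝ))) := by
      have h2 : η (sliceMap i (t, y)) = 1 := η.one_of_mem_closedBall
        (closedBall_subset_closedBall (by change (N : ℝ) ≤ N + 1; linarith) hx)
      simp only [u, h2, one_smul]
      exact (ENNReal.continuous_rpow_const.tendsto _).comp hy.enorm
    exact h1.liminf_eq.ge
  · rw [Set.indicator_of_notMem hx]
    exact zero_le

lemma lintegral_comp_smul_fin (f : (Fin 4 → ℝ) → ℝ≥0∞) {l : ℝ} (hl : 0 < l) :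
    ∫⁻ y, f y = ENNReal.ofReal (l ^ 4) * ∫⁻ y, f (l • y) := by
  have h1 : ∫⁻ y, f (l • y) = ENNReal.ofReal (l ^ 4)⁻¹ * ∫⁻ y, f y := by
    have h2 := (Homeomorph.smulOfNeZero (α := Fin 4 → ℝ) l hl.ne').measurableEmbedding.lintegral_map
      (μ := volume) f
    have h3 := Measure.map_addHaar_smul (volume : Measure (Fin 4 → ℝ)) hl.ne'
    simp only [Homeomorph.smulOfNeZero_apply] at h2
    rw [h3, lintegral_smul_measure] at h2
    rw [← h2]
    simp [abs_of_pos hl]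
  rw [h1, ← mul_assoc, ← ENNReal.ofReal_mul (by positivity),
    mul_inv_cancel₀ (by positivity), ENNReal.ofReal_one, one_mul]

/-- The cone of points whose `i`-th coordinate is comparable to their norm. -/
def coordCone (i : Fin 5) : Set E5 := {x | ‖x‖ < 3 * |x i|}

lemma measurableSet_coordCone (i : Fin 5) : MeasurableSet (coordCone i) := by
  have h : Continuous fun x : E5 => x i :=
    (EuclideanSpace.proj (𝕜 := ℝ) i : E5 →L[ℝ] ℝ).continuous
  exact (isOpen_lt continuous_norm (continuous_const.mul h.abs)).measurableSet

/-- Some coordinate satisfies 5 x_i² ≥ |x|², and 3² > 5. -/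
lemma exists_mem_coordCone {x : E5} (hx : x ≠ 0) : ∃ i, x ∈ coordCone i := by
  by_contra! h
  have h1 : ∀ i, 9 * x i ^ 2 ≤ ‖x‖ ^ 2 := fun i => by
    have h2 : 3 * |x i| ≤ ‖x‖ := not_lt.1 (h i)
    have h3 := pow_le_pow_left₀ (by positivity) h2 2
    rw [mul_pow, sq_abs] at h3
    linarith
  have h2 : ‖x‖ ^ 2 = ∑ i, x i ^ 2 := by
    simp [EuclideanSpace.norm_sq_eq]
  have h3 : ∑ i : Fin 5, 9 * x i ^ 2 ≤ ∑ _i : Fin 5, ‖x‖ ^ 2 := Finset.sum_le_sum fun i _ => h1 i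
  rw [← Finset.mul_sum, ← h2] at h3
  simp at h3
  have := norm_pos_iff.2 hx
  nlinarith

lemma smul_mem_coordCone {i : Fin 5} {l : ℝ} (hl : 0 < l) {x : E5} :
    l • x ∈ coordCone i ↔ x ∈ coordCone i := by
  simp only [coordCone, Set.mem_ofPred_eq, norm_smul, Real.norm_eq_abs, PiLp.smul_apply,
    smul_eq_mul, abs_mul, abs_of_pos hl]
  rw [mul_left_comm, mul_lt_mul_iff_of_pos_left hl]

/-- The critical Sobolev embedding on the sphere, in homogeneous form. -/
theorem MemW12Loc.lintegral_homogeneous_lt_top {V : E5 → E5} (hV : MemW12Loc V)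
    {H : E5 → ℝ≥0∞} (hH : ∀ l : ℝ, 0 < l → ∀ x, H (l • x) = H x)
    (hVH : ∀ᵐ x, ‖x‖ₑ ^ (4 : ℝ) * ‖V x‖ₑ ^ (4 : ℝ) = H x) (R : ℝ) :
    ∫⁻ x in closedBall 0 R, H x < ⊤ := by
  have hVm : AEStronglyMeasurable V := by
    obtain ⟨-, DV, hw, -⟩ := hV
    exact hw.locallyIntegrable.aestronglyMeasurable
  have hHm : AEMeasurable H :=
    ((continuous_enorm.measurable.pow_const _).aemeasurable.mul
      (hVm.enorm.pow_const _)).congr hVH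
  -- Inside a cone the slice at height t is bounded, so the slice integral of |V|⁴ controls that of
  -- H. Slice integrals of the homogeneous H scale by l⁴, hence finiteness at one positive and one
  -- negative height bounds them at every |t| ≤ R.
  set G : Fin 5 → E5 → ℝ≥0∞ := fun i => (coordCone i).indicator H
  have hGm : ∀ i, AEMeasurable (G i) := fun i => hHm.indicator (measurableSet_coordCone i)
  have hGs : ∀ i (l : ℝ), 0 < l → ∀ x, G i (l • x) = G i x := fun i l hl x => by
    by_cases hx : x ∈ coordCone i
    · simp only [G, Set.indicator_of_mem hx, Set.indicator_of_mem ((smul_mem_coordCone hl).2 hx),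
        hH l hl]
    · simp only [G, Set.indicator_of_notMem hx,
        Set.indicator_of_notMem (fun h => hx ((smul_mem_coordCone hl).1 h))]
  set I : Fin 5 → ℝ → ℝ≥0∞ := fun i t => ∫⁻ y : Fin 4 → ℝ, G i (sliceMap i (t, y))
  have hscale : ∀ i (l : ℝ), 0 < l → ∀ t, I i (l * t) = ENNReal.ofReal (l ^ 4) * I i t := by
    intro i l hl t
    simp only [I]
    rw [lintegral_comp_smul_fin _ hl]
    congr 2
    ext y
    have : (l * t, l • y) = l • (t, y) := rfl
    rw [this, map_smul, hGs i l hl]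
  -- The radius 6 below is 3 · 2: in the cone, |x| < 3|t| and |t| ≤ 2.
  have hfin : ∀ i, ∀ᵐ t : ℝ, |t| ≤ 2 → I i t < ⊤ := by
    intro i
    filter_upwards [hV.ae_lintegral_slice_lt_top i 6, ae_ae_slice i hVH] with t h1 h2 ht
    have h3 : I i t ≤ ∫⁻ y : Fin 4 → ℝ, ENNReal.ofReal 6 ^ (4 : ℝ)
        * (closedBall (0 : E5) (6 : ℕ)).indicator (fun x => ‖V x‖ₑ ^ (4 : ℝ))
          (sliceMap i (t, y)) := by
      apply lintegral_mono_ae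
      filter_upwards [h2] with y hy
      by_cases hx : sliceMap i (t, y) ∈ coordCone i
      · have hnorm : ‖sliceMap i (t, y)‖ ≤ 6 := by
          have h4 : ‖sliceMap i (t, y)‖ < 3 * |sliceMap i (t, y) i| := hx
          rw [sliceMap_coord] at h4
          dsimp only at h4
          linarith
        have hb : sliceMap i (t, y) ∈ closedBall (0 : E5) (6 : ℕ) := by
          rw [mem_closedBall_zero_iff]
          exact_mod_cast hnorm
        simp only [G]
        rw [Set.indicator_of_mem hx, Set.indicator_of_mem hb, ← hy]
        gcongr
        rw [← ofReal_norm]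
        exact ENNReal.ofReal_le_ofReal hnorm
      · simp only [G]
        rw [Set.indicator_of_notMem hx]
        exact zero_le
    refine h3.trans_lt ?_
    rw [lintegral_const_mul' _ _ (ENNReal.rpow_ne_top_of_nonneg (by norm_num)
      ENNReal.ofReal_ne_top)]
    exact ENNReal.mul_lt_top (ENNReal.rpow_lt_top_of_nonneg (by norm_num)
      ENNReal.ofReal_ne_top) h1
  have hcone : ∀ i, ∫⁻ x in closedBall 0 R, G i x < ⊤ := by
    intro i
    -- Reference heights of modulus greater than 1 keep the ratios t / t₁ and t / t₂ at most R.
    have hdense := Measure.dense_of_ae (hfin i)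
    obtain ⟨t₁, ht₁, hI₁⟩ := hdense.exists_mem_open isOpen_Ioo (⟨3 / 2, by norm_num, by norm_num⟩ :
      (Set.Ioo (1 : ℝ) 2).Nonempty)
    obtain ⟨t₂, ht₂, hI₂⟩ := hdense.exists_mem_open isOpen_Ioo
      (⟨-3 / 2, by norm_num, by norm_num⟩ : (Set.Ioo (-2 : ℝ) (-1)).Nonempty)
    have hI₁' : I i t₁ < ⊤ := ht₁ (by rw [abs_le]; constructor <;> linarith [hI₁.1, hI₁.2])
    have hI₂' : I i t₂ < ⊤ := ht₂ (by rw [abs_le]; constructor <;> linarith [hI₂.1, hI₂.2])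
    set M := ENNReal.ofReal (R ^ 4) * (I i t₁ + I i t₂)
    have hM : M < ⊤ :=
      ENNReal.mul_lt_top ENNReal.ofReal_lt_top (ENNReal.add_lt_top.2 ⟨hI₁', hI₂'⟩)
    have hIb : ∀ t, |t| ≤ R → I i t ≤ M := by
      intro t ht
      rcases lt_trichotomy t 0 with h0 | h0 | h0
      · have hl : 0 < t / t₂ := div_pos_of_neg_of_neg h0 (by linarith [hI₂.2])
        have hle : t / t₂ ≤ R := by
          rw [abs_of_neg h0] at ht
          rw [div_le_iff_of_neg (by linarith [hI₂.2])]
          nlinarith [hI₂.2]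
        have h1 := hscale i _ hl t₂
        rw [div_mul_cancel₀ _ (by linarith [hI₂.2] : t₂ ≠ 0 )] at h1
        rw [h1]
        exact mul_le_mul' (ENNReal.ofReal_le_ofReal (pow_le_pow_left₀ hl.le hle 4)) le_add_self
      · have : I i t = 0 := by
          refine lintegral_eq_zero_of_ae_eq_zero (Eventually.of_forall fun y => ?_)
          refine Set.indicator_of_notMem (fun hx => ?_) _
          have h4 : ‖sliceMap i (t, y)‖ < 3 * |sliceMap i (t, y) i| := hx
          rw [sliceMap_coord, h0] at h4
          simp at h4
          linarith [norm_nonneg (sliceMap i (0, y))]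
        rw [this]
        exact zero_le
      · have hl : 0 < t / t₁ := div_pos h0 (by linarith [hI₁.1])
        have hle : t / t₁ ≤ R := by
          rw [abs_of_pos h0] at ht
          rw [div_le_iff₀ (by linarith [hI₁.1])]
          nlinarith [hI₁.1]
        have h1 := hscale i _ hl t₁
        rw [div_mul_cancel₀ _ (by linarith [hI₁.1] : t₁ ≠ 0)] at h1
        rw [h1]
        exact mul_le_mul' (ENNReal.ofReal_le_ofReal (pow_le_pow_left₀ hl.le hle 4)) le_self_add
    rw [← lintegral_indicator measurableSet_closedBall,
      lintegral_eq_lintegral_slice i ((hGm i).indicator measurableSet_closedBall)]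
    have h5 : ∀ t : ℝ, ∫⁻ y : Fin 4 → ℝ, (closedBall (0 : E5) R).indicator (G i) (sliceMap i (t, y))
        ≤ (closedBall (0 : ℝ) R).indicator (fun _ => M) t := by
      intro t
      by_cases ht : |t| ≤ R
      · rw [Set.indicator_of_mem (by simpa using ht)]
        exact (lintegral_mono fun y => Set.indicator_le_self _ _ _).trans (hIb t ht)
      · refine le_of_eq_of_le (lintegral_eq_zero_of_ae_eq_zero (Eventually.of_forall fun y => ?_))
          zero_le
        refine Set.indicator_of_notMem (fun hx => ht ?_) _
        rw [mem_closedBall_zero_iff] at hx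
        have := PiLp.norm_apply_le (sliceMap i (t, y)) i
        rw [sliceMap_coord] at this
        exact this.trans hx
    refine (lintegral_mono h5).trans_lt ?_
    rw [lintegral_indicator measurableSet_closedBall, setLIntegral_const]
    exact ENNReal.mul_lt_top hM measure_closedBall_lt_top
  calc ∫⁻ x in closedBall 0 R, H x ≤ ∫⁻ x in closedBall 0 R, ∑ i, G i x := by
        apply lintegral_mono_ae
        filter_upwards [ae_restrict_of_ae ae_ne_zero_E5] with x hx
        obtain ⟨i, hi⟩ := exists_mem_coordCone hx
        refine le_trans (le_of_eq ?_) (Finset.single_le_sum (f := fun i => G i x)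
          (fun _ _ => zero_le) (Finset.mem_univ i))
        exact (Set.indicator_of_mem hi _).symm
    _ = ∑ i, ∫⁻ x in closedBall 0 R, G i x :=
        lintegral_finsetSum' _ fun i _ => (hGm i).restrict
    _ < ⊤ := ENNReal.sum_lt_top.2 fun i _ => hcone i

/-! ### Cubic test functions and the vanishing of F and g. -/

/-- Truncated cubic polynomials in the radial part. -/
noncomputable def truncatedCubic (χ : ℝ → ℝ) (α β γ c d : ℝ) (y : ℝ × ℝ) : ℝ :=
  y.1 * (α * y.1 ^ 2 + β * y.2 + γ) * (χ (c * y.1) * χ (d * y.2))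

lemma contDiff_truncatedCubic {χ : ℝ → ℝ} (hχ : ContDiff ℝ 1 χ) (α β γ c d : ℝ) :
    ContDiff ℝ 1 (truncatedCubic χ α β γ c d) := by
  have h1 : ContDiff ℝ 1 fun y : ℝ × ℝ => χ (c * y.1) := hχ.comp (contDiff_const.mul contDiff_fst)
  have h2 : ContDiff ℝ 1 fun y : ℝ × ℝ => χ (d * y.2) := hχ.comp (contDiff_const.mul contDiff_snd)
  exact (contDiff_fst.mul (((contDiff_const.mul (contDiff_fst.pow 2)).add
    (contDiff_const.mul contDiff_snd)).add contDiff_const)).mul (h1.mul h2)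

lemma hasCompactSupport_truncatedCubic {χ : ℝ → ℝ} (hχ : HasCompactSupport χ) (α β γ : ℝ)
    {c d : ℝ} (hc : c ≠ 0) (hd : d ≠ 0) : HasCompactSupport (truncatedCubic χ α β γ c d) := by
  have h1 : HasCompactSupport fun s : ℝ => χ (c * s) :=
    hχ.comp_homeomorph (Homeomorph.mulLeft₀ c hc)
  have h2 : HasCompactSupport fun s : ℝ => χ (d * s) :=
    hχ.comp_homeomorph (Homeomorph.mulLeft₀ d hd)
  refine HasCompactSupport.intro (h1.isCompact.prod h2.isCompact) fun y hy => ?_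
  by_contra h0
  refine hy ⟨subset_tsupport _ fun h => h0 ?_, subset_tsupport _ fun h => h0 ?_⟩
  · simp only [truncatedCubic]; rw [h]; ring
  · simp only [truncatedCubic]; rw [h]; ring

lemma fderiv_truncatedCubic {χ : ℝ → ℝ} (hχ : ContDiff ℝ 1 χ) (α β γ c d F g : ℝ) :
    fderiv ℝ (truncatedCubic χ α β γ c d) (F, g) (1, 0)
      = χ (d * g) * ((3 * α * F ^ 2 + β * g + γ) * χ (c * F)
        + (α * F ^ 2 + β * g + γ) * (c * F * deriv χ (c * F))) := by
  have hline : HasDerivAt (fun t : ℝ => (t, g)) ((1 : ℝ), (0 : ℝ)) F :=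
    (hasDerivAt_id F).prodMk (hasDerivAt_const F g)
  have h1 := ((contDiff_truncatedCubic hχ α β γ c d).differentiable one_ne_zero
    (F, g)).hasFDerivAt.comp_hasDerivAt F hline
  have hid := hasDerivAt_id F
  have h2 : HasDerivAt (fun t : ℝ => χ (c * t)) (deriv χ (c * F) * (c * 1)) F :=
    ((hχ.differentiable one_ne_zero (c * F)).hasDerivAt).comp F (hid.const_mul c)
  have h3 : HasDerivAt (fun t : ℝ => α * t ^ 2 + β * g + γ) (α * (2 * F)) F := by
    have := (((hasDerivAt_pow 2 F).const_mul α).add_const (β * g)).add_const γ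
    simpa using this
  have h4 := (hid.mul h3).mul (h2.mul_const (χ (d * g)))
  have h5 := h1.unique h4
  rw [h5]
  simp only [Pi.mul_apply, id]
  ring

section Limit

variable {V : E5 → E5} {P : E5 → ℝ} {DV : E5 → E5 →L[ℝ] E5}

/-- The numbers c₁, c₂, c₃ stand for χ(cF), cFχ′(cF), χ(dg). Once |g| ≤ G, every factor is O(F² + 1)
uniformly in c, so the integrand is O(F⁴ + 1); this is why F⁴ has to be locally integrable. -/
lemma cubic_flow_bound {α β γ G F g M c₁ c₂ c₃ : ℝ} (hG : |g| ≤ G) (hM : 0 ≤ M)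
    (h1 : |c₁| ≤ 1) (h2 : |c₂| ≤ M) (h3 : |c₃| ≤ 1) :
    |c₃ * (-3 * (F ^ 2 * (α * F ^ 2 + β * g + γ)) * c₁
      + ((3 * α * F ^ 2 + β * g + γ) * c₁ + (α * F ^ 2 + β * g + γ) * c₂) * (F ^ 2 - 2 * g))|
      ≤ (3 * (|α| + |β| * G + |γ|) + (3 * (|α| + |β| * G + |γ|) + (|α| + |β| * G + |γ|) * M)
        * (1 + 2 * G)) * (2 * F ^ 4 + 2) := by
  have hG0 : 0 ≤ G := (abs_nonneg g).trans hG
  set A := |α| + |β| * G + |γ|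
  have hA : 0 ≤ A := by positivity
  set s := F ^ 2 + 1
  have hs1 : 1 ≤ s := by nlinarith [sq_nonneg F]
  have hF2 : |F ^ 2| ≤ s := by rw [abs_of_nonneg (sq_nonneg F)]; simp [s]
  have hβg : |β * g| ≤ |β| * G := by
    rw [abs_mul]; exact mul_le_mul_of_nonneg_left hG (abs_nonneg _)
  have hn : |α * F ^ 2 + β * g + γ| ≤ A * s := by
    calc |α * F ^ 2 + β * g + γ| ≤ |α * F ^ 2| + |β * g| + |γ| := abs_add_three _ _ _
      _ ≤ |α| * s + |β| * G * s + |γ| * s := by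
          rw [abs_mul α]
          refine add_le_add (add_le_add (mul_le_mul_of_nonneg_left hF2 (abs_nonneg _)) ?_) ?_
          · exact hβg.trans (le_mul_of_one_le_right (by positivity) hs1)
          · exact le_mul_of_one_le_right (abs_nonneg _) hs1
      _ = A * s := by ring
  have hm : |3 * α * F ^ 2 + β * g + γ| ≤ 3 * A * s := by
    calc |3 * α * F ^ 2 + β * g + γ| = |2 * (α * F ^ 2) + (α * F ^ 2 + β * g + γ)| := by
          congr 1; ring
      _ ≤ |2 * (α * F ^ 2)| + |α * F ^ 2 + β * g + γ| := abs_add_le _ _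
      _ ≤ 2 * (|α| * s) + A * s := by
          refine add_le_add ?_ hn
          rw [abs_mul, abs_mul, abs_two]
          gcongr
      _ ≤ 3 * A * s := by
          have : |α| * s ≤ A * s := by
            refine mul_le_mul_of_nonneg_right ?_ (by linarith)
            have : 0 ≤ |β| * G := by positivity
            linarith [abs_nonneg γ]
          linarith
  have hd : |F ^ 2 - 2 * g| ≤ (1 + 2 * G) * s := by
    calc |F ^ 2 - 2 * g| ≤ |F ^ 2| + |2 * g| := abs_sub _ _
      _ ≤ s + 2 * G * s := by
          refine add_le_add hF2 ?_
          rw [abs_mul, abs_two]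
          calc 2 * |g| ≤ 2 * G := by linarith
            _ ≤ 2 * G * s := le_mul_of_one_le_right (by positivity) hs1
      _ = _ := by ring
  have hs0 : 0 ≤ s := by linarith
  have t1 : |-3 * (F ^ 2 * (α * F ^ 2 + β * g + γ)) * c₁| ≤ 3 * A * s ^ 2 := by
    rw [abs_mul, abs_mul, abs_mul (F ^ 2)]
    calc |(-3 : ℝ)| * (|F ^ 2| * |α * F ^ 2 + β * g + γ|) * |c₁|
        ≤ 3 * (s * (A * s)) * 1 := by
          have : |(-3 : ℝ)| = 3 := by norm_num
          rw [this]
          gcongr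
      _ = _ := by ring
  have t2 : |(3 * α * F ^ 2 + β * g + γ) * c₁ + (α * F ^ 2 + β * g + γ) * c₂|
      ≤ (3 * A + A * M) * s := by
    calc |(3 * α * F ^ 2 + β * g + γ) * c₁ + (α * F ^ 2 + β * g + γ) * c₂|
        ≤ |3 * α * F ^ 2 + β * g + γ| * |c₁| + |α * F ^ 2 + β * g + γ| * |c₂| := by
          rw [← abs_mul, ← abs_mul]; exact abs_add_le _ _
      _ ≤ 3 * A * s * 1 + A * s * M := by gcongr
      _ = _ := by ring
  have hs4 : s ^ 2 ≤ 2 * F ^ 4 + 2 := by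
    simp only [s]; nlinarith [sq_nonneg (F ^ 2 - 1)]
  calc _ ≤ 1 * (3 * A * s ^ 2 + (3 * A + A * M) * s * ((1 + 2 * G) * s)) := by
        rw [abs_mul]
        refine mul_le_mul h3 ((abs_add_le _ _).trans (add_le_add t1 ?_)) (abs_nonneg _) zero_le_one
        rw [abs_mul]
        gcongr
    _ = (3 * A + (3 * A + A * M) * (1 + 2 * G)) * s ^ 2 := by ring
    _ ≤ _ := by gcongr

/-- The integral identity for cubic polynomials in the radial part, with the transported quantity
truncated. -/
lemma IsHomogeneousSolution.integral_cubic (h : IsHomogeneousSolution V P DV)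
    (h4 : LocallyIntegrable fun x => radialPart V x ^ 4)
    {q : ℝ → ℝ} (hq : ContDiff ℝ ∞ q) (hqs : HasCompactSupport q)
    {s₀ : ℝ} (hs₀ : 0 < s₀) (hq0 : ∀ s < s₀, q s = 0) (χ : ContDiffBump (0 : ℝ))
    (α β γ : ℝ) {d : ℝ} (hd : 0 < d) :
    Integrable (fun x => q (‖x‖ ^ 2) * (χ (d * transported V P x)
      * ((-2 * β - 6 * α) * radialPart V x ^ 2 * transported V P x - 2 * γ * radialPart V x ^ 2
        - 2 * β * transported V P x ^ 2 - 2 * γ * transported V P x))) ∧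
    ∫ x, q (‖x‖ ^ 2) * (χ (d * transported V P x)
      * ((-2 * β - 6 * α) * radialPart V x ^ 2 * transported V P x - 2 * γ * radialPart V x ^ 2
        - 2 * β * transported V P x ^ 2 - 2 * γ * transported V P x)) = 0 := by
  have hχ1 : ContDiff ℝ 1 χ := χ.contDiff
  have hχ' : Continuous (deriv χ) := hχ1.continuous_deriv le_rfl
  have htq := isTestFunction_radial hq hqs
  -- Differentiating the cutoff in F produces sχ′(s) at s = cF, which is bounded uniformly in c and
  -- tends to 0 pointwise as c → 0.
  have hbc : Continuous fun s => s * deriv χ s := continuous_id.mul hχ'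
  have hbs : HasCompactSupport fun s => s * deriv χ s := χ.hasCompactSupport.deriv.mul_left
  obtain ⟨M, hM⟩ := hbs.exists_bound_of_continuous hbc
  have hM0 : 0 ≤ M := (norm_nonneg _).trans (hM 0)
  set G : ℝ := χ.rOut / d
  have hG : 0 ≤ G := (div_pos χ.rOut_pos hd).le
  set F := radialPart V
  set g := transported V P
  set K := (3 * (|α| + |β| * G + |γ|) + (3 * (|α| + |β| * G + |γ|) + (|α| + |β| * G + |γ|) * M)
        * (1 + 2 * G))
  set T : ℝ → ℝ → E5 → ℝ := fun c₁ c₂ x => χ (d * g x) *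
    (-3 * (F x ^ 2 * (α * F x ^ 2 + β * g x + γ)) * c₁
      + ((3 * α * F x ^ 2 + β * g x + γ) * c₁ + (α * F x ^ 2 + β * g x + γ) * c₂)
        * (F x ^ 2 - 2 * g x))
  have hTb : ∀ c₁ c₂ x, |c₁| ≤ 1 → |c₂| ≤ M → |T c₁ c₂ x| ≤ K * (2 * F x ^ 4 + 2) := by
    intro c₁ c₂ x h1 h2
    by_cases hg : |g x| ≤ G
    · exact cubic_flow_bound hg hM0 h1 h2 (by rw [abs_of_nonneg χ.nonneg]; exact χ.le_one)
    · have hz : χ (d * g x) = 0 := by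
        refine χ.zero_of_le_dist ?_
        rw [Real.dist_eq, sub_zero, abs_mul, abs_of_pos hd, mul_comm, ← div_le_iff₀ hd]
        exact (not_le.1 hg).le
      simp only [T, hz, zero_mul, abs_zero]
      positivity
  have hdom : Integrable fun x => |q (‖x‖ ^ 2)| * (K * (2 * F x ^ 4 + 2)) := by
    have h5 : LocallyIntegrable fun x => K * (2 * F x ^ 4 + 2) :=
      ((h4.smul (2 : ℝ)).add (locallyIntegrable_const (2 : ℝ))).smul K
    have h6 := htq.integrable_mul h5
    refine h6.norm.congr (Eventually.of_forall fun x => ?_)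
    dsimp only
    rw [norm_mul, Real.norm_eq_abs, Real.norm_eq_abs, abs_of_nonneg (a := K * _) (by positivity)]
  set c : ℕ → ℝ := fun n => 1 / ((n : ℝ) + 1)
  have hc0 : ∀ n, 0 < c n := fun n => by positivity
  have hclim : Tendsto c atTop (𝓝 0) := tendsto_one_div_add_atTop_nhds_zero_nat
  set U : ℕ → E5 → ℝ := fun n x =>
    q (‖x‖ ^ 2) * T (χ (c n * F x)) (c n * F x * deriv χ (c n * F x)) x
  have hFm := h.aestronglyMeasurable_radialPart
  have hU : ∀ n, ∫ x, U n x = 0 := by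
    intro n
    refine Eq.trans (integral_congr_ae (Eventually.of_forall fun x => ?_))
      (h.integral_identity hq hqs hs₀ hq0 (contDiff_truncatedCubic hχ1 α β γ (c n) d)
        (hasCompactSupport_truncatedCubic χ.hasCompactSupport α β γ (hc0 n).ne' hd.ne'))
    simp only [fderiv_truncatedCubic hχ1, truncatedCubic, U, T, F, g]
    ring
  have hcont : ∀ n, Continuous fun y : ℝ × ℝ => χ (d * y.2) *
    (-3 * (y.1 ^ 2 * (α * y.1 ^ 2 + β * y.2 + γ)) * χ (c n * y.1)
      + ((3 * α * y.1 ^ 2 + β * y.2 + γ) * χ (c n * y.1) + (α * y.1 ^ 2 + β * y.2 + γ)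
        * (c n * y.1 * deriv χ (c n * y.1))) * (y.1 ^ 2 - 2 * y.2)) := by
    intro n
    have e1 : Continuous fun y : ℝ × ℝ => χ (d * y.2) := χ.continuous.comp (by fun_prop)
    have e2 : Continuous fun y : ℝ × ℝ => χ (c n * y.1) := χ.continuous.comp (by fun_prop)
    have e3 : Continuous fun y : ℝ × ℝ => deriv χ (c n * y.1) := hχ'.comp (by fun_prop)
    fun_prop
  have hlim : ∀ x, Tendsto (fun n => U n x) atTop (𝓝 (q (‖x‖ ^ 2) * T 1 0 x)) := by
    intro x
    have l0 : Tendsto (fun n => c n * F x) atTop (𝓝 0) := by simpa using hclim.mul_const (F x)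
    have l1 : Tendsto (fun n => χ (c n * F x)) atTop (𝓝 1) := by
      have := (χ.continuous.tendsto 0).comp l0
      rwa [χ.one_of_mem_closedBall (mem_closedBall_self χ.rIn_pos.le)] at this
    have l2 : Tendsto (fun n => c n * F x * deriv χ (c n * F x)) atTop (𝓝 0) := by
      have := (hbc.tendsto 0).comp l0
      simp only [zero_mul] at this
      exact this
    exact (((l1.const_mul _).add (((l1.const_mul _).add (l2.const_mul _)).mul_const _)).const_mul
      _).const_mul _
  -- The terms −3αF⁴ and 3αF² · F² cancel: the coefficient −3 matches the cubic degree of the test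
  -- function.
  have hTeq : ∀ x, q (‖x‖ ^ 2) * T 1 0 x = q (‖x‖ ^ 2) * (χ (d * g x)
      * ((-2 * β - 6 * α) * F x ^ 2 * g x - 2 * γ * F x ^ 2
        - 2 * β * g x ^ 2 - 2 * γ * g x)) := by
    intro x
    simp only [T]
    ring
  have hUm : ∀ n, AEStronglyMeasurable (U n) := fun n =>
    htq.1.continuous.aestronglyMeasurable.mul (h.aestronglyMeasurable_comp (hcont n))
  have hbound : ∀ c₁ c₂ x, |c₁| ≤ 1 → |c₂| ≤ M →
      ‖q (‖x‖ ^ 2) * T c₁ c₂ x‖ ≤ |q (‖x‖ ^ 2)| * (K * (2 * F x ^ 4 + 2)) := by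
    intro c₁ c₂ x h1 h2
    rw [norm_mul]
    exact mul_le_mul_of_nonneg_left (hTb c₁ c₂ x h1 h2) (abs_nonneg _)
  have hχabs : ∀ s, |χ s| ≤ 1 := fun s => by rw [abs_of_nonneg χ.nonneg]; exact χ.le_one
  have hconv := tendsto_integral_of_dominated_convergence _ hUm hdom
    (fun n => Eventually.of_forall fun x => hbound _ _ x (hχabs _) (hM _))
    (Eventually.of_forall hlim)
  simp only [hU] at hconv
  have hzero := tendsto_nhds_unique hconv tendsto_const_nhds
  simp only [hTeq] at hzero
  refine ⟨?_, hzero⟩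
  simp only [← hTeq]
  exact hdom.mono' (aestronglyMeasurable_of_tendsto_ae atTop hUm (Eventually.of_forall hlim))
    (Eventually.of_forall fun x => hbound 1 0 x (by simp) (by simpa using hM0))

/-- The radial part and the transported quantity of a homogeneous solution vanish. -/
theorem IsHomogeneousSolution.ae_eq_zero (h : IsHomogeneousSolution V P DV)
    (h4 : LocallyIntegrable fun x => radialPart V x ^ 4) :
    ∀ᵐ x, 1 < ‖x‖ ^ 2 → ‖x‖ ^ 2 < 3 → radialPart V x = 0 ∧ transported V P x = 0 := by
  -- This weight is positive exactly on 1 < s < 3, so s₀ = 1 is admissible.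
  set q : ContDiffBump (2 : ℝ) := ⟨1 / 2, 1, by norm_num, by norm_num⟩
  set χ : ContDiffBump (0 : ℝ) := ⟨1, 2, one_pos, one_lt_two⟩
  have hq : ContDiff ℝ ∞ q := q.contDiff
  have hq0 : ∀ s < (1 : ℝ), q s = 0 := fun s hs => q.zero_of_le_dist (by
    rw [Real.dist_eq, abs_of_neg (by linarith)]
    change 1 ≤ _
    linarith)
  have hqpos : ∀ s : ℝ, 1 < s → s < 3 → 0 < q s := fun s h1 h3 => q.pos_of_mem_ball (by
    rw [mem_ball, Real.dist_eq, abs_lt]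
    change -1 < _ ∧ _ < 1
    constructor <;> linarith)
  have hχ1 : ∀ s : ℝ, |s| ≤ 1 → χ s = 1 := fun s hs =>
    χ.one_of_mem_closedBall (by rwa [mem_closedBall, Real.dist_eq, sub_zero])
  have hg : ∀ᵐ x, ∀ n : ℕ, q (‖x‖ ^ 2) * (χ (1 / ((n : ℝ) + 1) * transported V P x)
      * (4 * transported V P x ^ 2)) = 0 := by
    rw [ae_all_iff]
    intro n
    -- The choice α = 2/3, β = −2 cancels the F²g term, the only remaining one of indefinite sign,
    -- and leaves 4g².
    obtain ⟨hi, h0⟩ := h.integral_cubic h4 hq q.hasCompactSupport one_pos hq0 χ (2 / 3) (-2) 0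
      (d := 1 / ((n : ℝ) + 1)) (by positivity)
    have heq : ∀ x, q (‖x‖ ^ 2) * (χ (1 / ((n : ℝ) + 1) * transported V P x)
      * ((-2 * -2 - 6 * (2 / 3)) * radialPart V x ^ 2 * transported V P x
        - 2 * 0 * radialPart V x ^ 2 - 2 * -2 * transported V P x ^ 2
        - 2 * 0 * transported V P x)) = q (‖x‖ ^ 2) *
        (χ (1 / ((n : ℝ) + 1) * transported V P x) * (4 * transported V P x ^ 2)) := by
      intro x; ring
    simp only [heq] at hi h0
    exact (integral_eq_zero_iff_of_nonneg (fun x =>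
      mul_nonneg q.nonneg (mul_nonneg χ.nonneg (by positivity))) hi).1 h0
  have hg0 : ∀ᵐ x, q (‖x‖ ^ 2) ≠ 0 → transported V P x = 0 := by
    filter_upwards [hg] with x hx hqx
    -- Once n ≥ |g|, the cutoff equals 1 at this point.
    obtain ⟨n, hn⟩ := exists_nat_ge |transported V P x|
    have h1 := hx n
    rw [hχ1, one_mul] at h1
    · rcases mul_eq_zero.1 h1 with h2 | h2
      · exact absurd h2 hqx
      · simpa using h2
    · rw [abs_mul, abs_of_pos (by positivity), one_div, inv_mul_le_iff₀ (by positivity)]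
      linarith
  have hF : ∀ᵐ x, q (‖x‖ ^ 2) * (2 * radialPart V x ^ 2) = 0 := by
    -- Where q is nonzero, g = 0 is now known, so the linear test function F leaves −2F² and any
    -- fixed cutoff scale will do.
    obtain ⟨hi, h0⟩ := h.integral_cubic h4 hq q.hasCompactSupport one_pos hq0 χ 0 0 1
      (d := 1) one_pos
    have heq : ∀ᵐ x, q (‖x‖ ^ 2) * (χ (1 * transported V P x)
      * ((-2 * 0 - 6 * 0) * radialPart V x ^ 2 * transported V P x
        - 2 * 1 * radialPart V x ^ 2 - 2 * 0 * transported V P x ^ 2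
        - 2 * 1 * transported V P x)) = -(q (‖x‖ ^ 2) * (2 * radialPart V x ^ 2)) := by
      filter_upwards [hg0] with x hx
      by_cases hqx : q (‖x‖ ^ 2) = 0
      · simp [hqx]
      · rw [hx hqx, hχ1 _ (by simp)]
        ring
    have hi' := (hi.congr heq).neg
    rw [integral_congr_ae heq, integral_neg, neg_eq_zero] at h0
    simp only [Pi.neg_def, neg_neg] at hi'
    exact (integral_eq_zero_iff_of_nonneg (fun x => mul_nonneg q.nonneg (by positivity)) hi').1 h0
  filter_upwards [hg0, hF] with x h1 h2 hx1 hx3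
  have hpos := hqpos _ hx1 hx3
  refine ⟨?_, h1 hpos.ne'⟩
  rcases mul_eq_zero.1 h2 with h3 | h3
  · exact absurd h3 hpos.ne'
  · simpa using h3

end Limit

/-! ### From the shell to the sphere. -/

/-- A property of directions valid almost everywhere on a shell is valid almost everywhere on the
sphere. -/
lemma ae_surfaceMeasure_of_ae_shell {Q : S4 → Prop}
    (h : ∀ᵐ x : E5, ∀ hx : x ≠ 0, 1 < ‖x‖ ^ 2 → ‖x‖ ^ 2 < 3 → Q (direction x hx)) :
    ∀ᵐ σ ∂surfaceMeasure, Q σ := by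
  have hmp := (volume : Measure E5).measurePreserving_homeomorphUnitSphereProd
  have hsymm : MeasurePreserving (homeomorphUnitSphereProd E5).symm
      ((volume : Measure E5).toSphere.prod (Measure.volumeIoiPow (Module.finrank ℝ E5 - 1)))
      ((volume : Measure E5).comap (↑)) :=
    MeasurePreserving.symm (homeomorphUnitSphereProd E5).toMeasurableEquiv hmp
  have h1 : ∀ᵐ x : ({0}ᶜ : Set E5) ∂((volume : Measure E5).comap (↑)),
      1 < ‖(x : E5)‖ ^ 2 → ‖(x : E5)‖ ^ 2 < 3 → Q (direction x x.2) := by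
    have h2 := (ae_restrict_iff_subtype (μ := (volume : Measure E5))
      (measurableSet_singleton (0 : E5)).compl
      (p := fun x => ∀ hx : x ≠ 0, 1 < ‖x‖ ^ 2 → ‖x‖ ^ 2 < 3 → Q (direction x hx))).1
      (ae_restrict_of_ae h)
    filter_upwards [h2] with x hx using hx x.2
  have h3 := hsymm.quasiMeasurePreserving.ae h1
  have h4 : ∀ᵐ z ∂((volume : Measure E5).toSphere.prod
      (Measure.volumeIoiPow (Module.finrank ℝ E5 - 1))),
      1 < (z.2 : ℝ) ^ 2 → (z.2 : ℝ) ^ 2 < 3 → Q z.1 := by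
    filter_upwards [h3] with z hz
    have hpos : (0 : ℝ) < z.2 := z.2.2
    have hz1 : ((homeomorphUnitSphereProd E5).symm z : E5) = (z.2 : ℝ) • (z.1 : E5) := by simp
    have hnz : ‖(z.1 : E5)‖ = 1 := mem_sphere_zero_iff_norm.1 z.1.2
    have hn : ‖((homeomorphUnitSphereProd E5).symm z : E5)‖ = z.2 := by
      rw [hz1, norm_smul, hnz, mul_one, Real.norm_eq_abs, abs_of_pos hpos]
    have hd : direction ((homeomorphUnitSphereProd E5).symm z : E5)
        ((homeomorphUnitSphereProd E5).symm z).2 = z.1 := by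
      apply Subtype.ext
      simp only [direction, hn]
      rw [hz1, smul_smul, inv_mul_cancel₀ hpos.ne', one_smul]
    rw [hn, hd] at hz
    exact hz
  filter_upwards [Measure.ae_ae_of_ae_prod h4] with σ hσ
  by_contra hQ
  have h5 : Measure.volumeIoiPow (Module.finrank ℝ E5 - 1)
      {r : Set.Ioi (0 : ℝ) | 1 < (r : ℝ) ^ 2 ∧ (r : ℝ) ^ 2 < 3} = 0 := by
    refine measure_mono_null (fun r hr => ?_) (ae_iff.1 hσ)
    exact fun hcon => hQ (hcon hr.1 hr.2)
  -- The radial interval [11/10, 3/2) lies in the shell, since 1.21 > 1 and 2.25 < 3. If the shell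
  -- were null, the radial measures of (0, 3/2) and (0, 11/10) would compare the wrong way.
  have h6 : Set.Iio (⟨3 / 2, by norm_num [Set.mem_Ioi]⟩ : Set.Ioi (0 : ℝ)) ⊆
      Set.Iio (⟨11 / 10, by norm_num [Set.mem_Ioi]⟩ : Set.Ioi (0 : ℝ)) ∪
        {r : Set.Ioi (0 : ℝ) | 1 < (r : ℝ) ^ 2 ∧ (r : ℝ) ^ 2 < 3} := by
    intro r hr
    have hr' : (r : ℝ) < 3 / 2 := hr
    by_cases hr1 : (r : ℝ) < 11 / 10
    · exact Or.inl hr1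
    · rw [not_lt] at hr1
      exact Or.inr ⟨by nlinarith, by nlinarith⟩
  have h7 := (measure_mono h6).trans (measure_union_le
    (μ := Measure.volumeIoiPow (Module.finrank ℝ E5 - 1)) _ _)
  rw [h5, add_zero, Measure.volumeIoiPow_apply_Iio, Measure.volumeIoiPow_apply_Iio] at h7
  rw [ENNReal.ofReal_le_ofReal_iff (by positivity)] at h7
  norm_num at h7

theorem theorem4p1
    (V : E5 → E5) (P : E5 → ℝ)
    (v : S4 → E5) (f p : S4 → ℝ)
    (hV : MemW12Loc V)
    (hP : MemLpLoc P 1)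
    (hv : ∀ᵐ σ ∂surfaceMeasure, ⟪v σ, (σ : E5)⟫ = 0)
    (hVform : ∀ᵐ x : E5, ∀ hx : x ≠ 0,
      V x = ‖x‖⁻¹ • (v (direction x hx) + f (direction x hx) • (direction x hx : E5)))
    (hPform : ∀ᵐ x : E5, ∀ hx : x ≠ 0, P x = p (direction x hx) / ‖x‖ ^ 2)
    (hEuler : IsStationaryEulerSolution V P) :
    ∀ᵐ σ ∂surfaceMeasure, f σ = 0 ∧ ‖v σ‖ ^ 2 + 2 * p σ = 0 := by
  obtain ⟨hVloc, hPloc, hdiv, DV, hDV, hacc, hmom⟩ := hEuler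
  set w : S4 → E5 := fun σ => v σ + f σ • (σ : E5)
  have hnorm : ∀ᵐ x : E5, ∀ hx : x ≠ 0, ‖x‖ * ‖V x‖ = ‖w (direction x hx)‖ := by
    filter_upwards [hVform] with x h1 hx
    have := norm_ne_zero_iff.2 hx
    rw [h1 hx, norm_smul, norm_inv, norm_norm, mul_inv_cancel_left₀ this]
  have hrad : ∀ᵐ x : E5, ∀ hx : x ≠ 0,
      radialPart V x = ⟪w (direction x hx), (direction x hx : E5)⟫ := by
    filter_upwards [hVform] with x h1 hx
    rw [radialPart, h1 hx]
    change ⟪x, ‖x‖⁻¹ • w (direction x hx)⟫ = ⟪w (direction x hx), ‖x‖⁻¹ • x⟫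
    rw [inner_smul_right, inner_smul_right, real_inner_comm]
  have htra : ∀ᵐ x : E5, ∀ hx : x ≠ 0, transported V P x
      = ⟪w (direction x hx), (direction x hx : E5)⟫ ^ 2 / 2
        - (‖w (direction x hx)‖ ^ 2 / 2 + p (direction x hx)) := by
    filter_upwards [hrad, hnorm, hPform] with x h1 h2 h3 hx
    have := norm_ne_zero_iff.2 hx
    rw [transported, h1 hx, h3 hx, ← h2 hx]
    field_simp
  have hhomP : IsHomogeneousAE 2 P := isHomogeneousAE_of_direction hPform
  have hsol : IsHomogeneousSolution V P DV :=
    { weak_velocity := hDV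
      locallyIntegrable_acceleration := hacc
      weak_pressure := hasWeakFDeriv_pressure hacc hPloc hmom
      trace_eq_zero := hDV.ae_trace_eq_zero hdiv
      inner_acceleration := ae_inner_self_eq_two_mul hacc hPloc hhomP hmom
      homogeneous_radialPart := isHomogeneousAE_of_direction (m := 0)
        (z := fun σ => ⟪w σ, (σ : E5)⟫) (by simpa using hrad)
      homogeneous_transported := isHomogeneousAE_of_direction (m := 0)
        (z := fun σ => ⟪w σ, (σ : E5)⟫ ^ 2 / 2 - (‖w σ‖ ^ 2 / 2 + p σ)) (by simpa using htra) }
  classical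
  -- A representative of |x|⁴|V|⁴ that is homogeneous at every point, not only almost everywhere.
  set H : E5 → ℝ≥0∞ := fun x => if hx : x ≠ 0 then ‖w (direction x hx)‖ₑ ^ (4 : ℝ) else 0
  have hH : ∀ l : ℝ, 0 < l → ∀ x, H (l • x) = H x := by
    intro l hl x
    by_cases hx : x ≠ 0
    · have hlx : l • x ≠ 0 := smul_ne_zero hl.ne' hx
      simp only [H, dif_pos hx, dif_pos hlx, direction_smul hl hx hlx]
    · rw [not_not] at hx
      simp [hx]
  have hVH : ∀ᵐ x, ‖x‖ₑ ^ (4 : ℝ) * ‖V x‖ₑ ^ (4 : ℝ) = H x := by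
    filter_upwards [hnorm, ae_ne_zero_E5] with x h1 hx
    simp only [H, dif_pos hx]
    rw [← ENNReal.mul_rpow_of_nonneg _ _ (by norm_num), ← ofReal_norm, ← ofReal_norm,
      ← ENNReal.ofReal_mul (norm_nonneg _), h1 hx, ofReal_norm]
  have h4 : LocallyIntegrable fun x => radialPart V x ^ 4 := by
    refine locallyIntegrable_iff.2 fun K hK => ?_
    obtain ⟨R, hR⟩ := hK.isBounded.subset_closedBall 0
    refine IntegrableOn.mono_set ⟨(hsol.aestronglyMeasurable_radialPart.pow 4).restrict, ?_⟩ hR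
    refine lt_of_le_of_lt ?_ (hV.lintegral_homogeneous_lt_top hH hVH R)
    apply lintegral_mono_ae
    filter_upwards [ae_restrict_of_ae hVH] with x hx
    rw [← hx, ← ENNReal.mul_rpow_of_nonneg _ _ (by norm_num), ← ofReal_norm, ← ofReal_norm,
      ← ofReal_norm, ← ENNReal.ofReal_mul (norm_nonneg _),
      ENNReal.ofReal_rpow_of_nonneg (by positivity) (by norm_num)]
    refine ENNReal.ofReal_le_ofReal ?_
    rw [norm_pow]
    exact_mod_cast pow_le_pow_left₀ (norm_nonneg _) (abs_real_inner_le_norm x (V x)) 4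
  have hfinal : ∀ᵐ σ ∂surfaceMeasure, ⟪w σ, (σ : E5)⟫ = 0 ∧
      ⟪w σ, (σ : E5)⟫ ^ 2 / 2 - (‖w σ‖ ^ 2 / 2 + p σ) = 0 := by
    apply ae_surfaceMeasure_of_ae_shell
    filter_upwards [hsol.ae_eq_zero h4, hrad, htra] with x h1 h2 h3 hx hx1 hx3
    rw [← h2 hx, ← (h2 hx ▸ h3 hx : transported V P x = radialPart V x ^ 2 / 2
      - (‖w (direction x hx)‖ ^ 2 / 2 + p (direction x hx)))]
    exact h1 hx1 hx3
  filter_upwards [hfinal, hv] with σ h1 h2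
  obtain ⟨h3, h5⟩ := h1
  have hσ : ‖(σ : E5)‖ = 1 := mem_sphere_zero_iff_norm.1 σ.2
  -- Tangentiality of v makes the radial part of w = v + fσ equal to f.
  have hf : f σ = 0 := by
    simp only [w] at h3
    rw [inner_add_left, h2, inner_smul_left, real_inner_self_eq_norm_sq, hσ] at h3
    simpa using h3
  refine ⟨hf, ?_⟩
  rw [h3] at h5
  simp only [w, hf, zero_smul, add_zero] at h5
  linarith
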